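/- **Formulas.** Fix a set of sorts with a distinguished sort $\mathtt{loc}$; for each sort, countably infinitely many variables and a set of constants (none of sort $\mathtt{loc}$); and predicate symbols $p$, each with a profile $(\mathtt{loc},\mathtt s_2,\dots,\mathtt s_n)$, $n\ge 1$. Spatial atoms are $x\mapsto(t_1,\dots,t_k)$ ($x$ a variable of sort $\mathtt{loc}$, the $t_i$ terms) and well-sorted $p(x,t_2,\dots,t_n)$; $x$ is the root. Spatial formulas $\phi,\psi$ are multisets of spatial atoms combined by $*$ ($\mathit{emp}$ if empty). Pure formulas $\xi,\zeta$ are finite conjunctions of equations $t\approx s$ and disequations $t\not\approx s$ between terms of the same sort, modulo associativity, commutativity and contraction of $\wedge$ and symmetry of $\approx,\not\approx$ ($\top$ if empty). A symbolic heap is $\phi\curlywedge\xi$. $\mathcal V(\cdot)$ is the set of variables, $\mathcal V_{\mathtt{loc}}(\cdot)$ the set of those of sort $\mathtt{loc}$, and $\mathit{alloc}(\phi)$ the multiset of roots of the atoms of $\phi$. **Rules of $\mathfrak R$.** Let $\mathfrak R$ be a finite set of inductive rules $p(x_1,\dots,x_n)\Leftarrow\lambda$ ($x_i$ pairwise distinct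 variables of the right sorts, $\lambda$ a symbolic heap); write $p(\vec t)\Leftarrow_{\mathfrak R}\lambda'$ if $\lambda'$ arises from a rule by renaming its existential variables (those of $\lambda$ other than the $x_i$) to pairwise distinct variables not in $\vec t$ and replacing each $x_i$ by $t_i$. A $\mathtt P$-rule is a rule $p(x_1,\dots,x_n)\Leftarrow x_1\mapsto(y_1,\dots,y_k)*q_1(z_1,\vec u_1)*\dots*q_m(z_m,\vec u_m)\curlywedge\xi$ ($m\ge 0$) such that: $\xi$ is a conjunction of disequations $u\not\approx v$ with $u\in\{\vec x,\vec y\}$ and $v\in\{\vec y\}\setminus\{\vec x\}$; the $z_j$ are pairwise distinct and are exactly the variables of sort $\mathtt{loc}$ in $\{\vec y\}\setminus\{\vec x\}$; every element of $\vec u_j$ is in $\{\vec x,\vec y\}$ or is a constant. A set of $\mathtt P$-rules is $\mathtt{loc}$-deterministic if (a) for any two distinct rules with the same head symbol, renamed apart, with parameters $\vec x_i$, records $\vec t_i$ and pure parts $\xi_i$, the formula $\vec x_1\approx\vec x_2\wedge\vec t_1\approx\vec t_2\wedge\xi_1\wedge\xi_2$ is unsatisfiable, and (b) all disequations in the rules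 are between variables of sort $\mathtt{loc}$. $\mathit{width}(\mathfrak R)$ is the maximum of the arities of the predicate symbols and of the record lengths in $\mathfrak R$. **Semantics.** Fix pairwise disjoint countably infinite sets $\mathfrak U_{\mathtt s}$ and an injective sort-preserving interpretation of the constants. A store $\mathfrak s$ maps variables of sort $\mathtt s$ to $\mathfrak U_{\mathtt s}$ (and constants to their interpretation); a heap $\mathfrak h$ is a finite partial map from $\mathfrak U_{\mathtt{loc}}$ to finite tuples of elements. $(\mathfrak s,\mathfrak h)\models_{\mathfrak R}$ is the usual satisfaction relation of separation logic: $\mathit{emp}$ means $\mathfrak h=\emptyset$; $x\mapsto\vec t$ means $\mathfrak h=\{(\mathfrak s(x),\mathfrak s(\vec t))\}$; $*$ splits $\mathfrak h$ into disjoint parts; pure formulas are evaluated in $\mathfrak s$; and $p(\vec t)$ holds iff (inductively) $p(\vec t)\Leftarrow_{\mathfrak R}\lambda$ and $(\mathfrak s',\mathfrak h)\models_{\mathfrak R}\lambda$ for some $\lambda$ and some $\mathfrak s'$ equal to $\mathfrak s$ outside $\mathcal V(\lambda)\setminus\mathcal V(p(\vec t))$. A sequent $\lambda\vdash^V\gamma$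 consists of two symbolic heaps and a finite multiset $V$ of variables of sort $\mathtt{loc}$. It is valid if there is no counter-model, i.e. no $(\mathfrak s,\mathfrak h)$ with $(\mathfrak s,\mathfrak h)\models_{\mathfrak R}\lambda$, $(\mathfrak s,\mathfrak h)\not\models_{\mathfrak R}\gamma$, $\mathfrak s(x)\notin\mathrm{dom}(\mathfrak h)$ for all $x\in V$, and $\mathfrak s(x)\ne\mathfrak s(y)$ whenever $\{x,y\}$ is a sub-multiset of $V$. **Inference rules** (premises / conclusion). Write $\lambda\triangleright_V\xi$ if every atom of $\xi$ occurs in $\lambda$, or is $t\approx t$ for a variable $t$, or is $c\not\approx d$ for distinct constants, or is $x\not\approx y$ with $\{x,y\}$ a sub-multiset of $\mathit{alloc}(\lambda)+V$. In $\mathtt R,\mathtt E,\mathtt W$ the deleted pure formula is nonempty and has no atom in common with the remaining pure formula, so that the premise differs from the conclusion. - $\mathtt R$: $(\phi\curlywedge\xi\vdash^{V}\gamma)\{x\leftarrow t\}$ / $\phi\curlywedge(x\approx t\wedge\xi)\vdash^V\gamma$, for $x$ a variable. - $\mathtt E$: $\lambda\vdash^V\psi\curlywedge\zeta$ / $\lambda\vdash^V\psi\curlywedge(\zeta\wedge\zeta')$,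 if $\lambda\triangleright_V\zeta'$. - $\mathtt S$: $\phi_1\curlywedge\xi_1\vdash^{V+\mathit{alloc}(\phi_2)}\psi_1\curlywedge\zeta_1$ and $\phi_2\curlywedge\xi_2\vdash^{V+\mathit{alloc}(\phi_1)}\psi_2\curlywedge\zeta_2$ / $(\phi_1*\phi_2)\curlywedge(\xi_1\wedge\xi_2)\vdash^V(\psi_1*\psi_2)\curlywedge(\zeta_1\wedge\zeta_2)$, if $\phi_1,\phi_2\ne\mathit{emp}$. - $\mathtt U$: $(\phi'_i*\phi)\curlywedge(\xi'_i\wedge\xi)\vdash^V\gamma$ for $i=1,\dots,n$ / $(p(\vec t)*\phi)\curlywedge\xi\vdash^V\gamma$, where the $\phi'_i\curlywedge\xi'_i$ are the unfoldings $p(\vec t)\Leftarrow_{\mathfrak R}\phi'_i\curlywedge\xi'_i$, one for each rule of $\mathfrak R$ with head $p$, the existential variables being renamed to variables not in the conclusion. - $\mathtt I$: $(x\mapsto\vec y*\phi)\curlywedge\xi\vdash^V(x\mapsto\vec y*\psi'\sigma*\psi)\curlywedge\zeta$ / $(x\mapsto\vec y*\phi)\curlywedge\xi\vdash^V(p(x,\vec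 z)*\psi)\curlywedge\zeta$, if $p(x,\vec z)\Leftarrow_{\mathfrak R}(x\mapsto\vec u*\psi')\curlywedge\zeta'$, $\sigma$ is a substitution with $\vec u\sigma=\vec y$ and domain included in $\{\vec u\}\setminus\{x,\vec z\}$, and $(x\mapsto\vec y*\phi)\curlywedge\xi\triangleright_V\zeta'\sigma$. - $\mathtt W$: $\phi\curlywedge\xi\vdash^V\gamma$ / $\phi\curlywedge(\xi\wedge\xi')\vdash^V\gamma$, if either $\xi'$ is a disequation with $\phi\triangleright_V\xi'$, or $\xi'=\bigwedge_i x\not\approx y_i$ with $x$ a variable not in $\mathcal V(\phi)\cup\mathcal V(\xi)\cup\mathcal V(\gamma)\cup\{y_i\}_i$. - $\mathtt C$: $(\phi\curlywedge\xi\vdash^V\gamma)\{x\leftarrow y\}$ and $\phi\curlywedge(\xi\wedge x\not\approx y)\vdash^V\gamma$ / $\phi\curlywedge\xi\vdash^V\gamma$, for variables $x,y$ of sort $\mathtt{loc}$. - $\mathtt V$: $\lambda\vdash^V\gamma$ / $\lambda\vdash^{V+\{x\}}\gamma$, if $x\notin\mathcal V(\lambda)\cup\mathcal V(\gamma)$.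 **Axioms and anti-axioms.** $\phi\curlywedge\xi\vdash^V\psi\curlywedge\zeta$ is an axiom if $\phi=\psi$ and every atom of $\zeta$ is in $\xi$; or $\xi$ contains some $t\not\approx t$; or a variable occurs twice in $\mathit{alloc}(\phi)$; or $\mathit{alloc}(\phi)\cap V\ne\emptyset$; or a variable occurs twice in $V$. Let $\mathit{out}(p)$ be the least family of sets of indices such that $i\in\mathit{out}(p)$ whenever the $i$-th argument of $p$ is of sort $\mathtt{loc}$ and $\mathfrak R$ has a rule $p(x_1,\dots,x_n)\Leftarrow\lambda$ where $\lambda$ contains an atom $x_1\mapsto\vec t$ with $x_i\in\vec t$, or an atom $q(t_1,\dots,t_m)$ with $t_j=x_i$ for some $j\in\mathit{out}(q)$. For variables of sort $\mathtt{loc}$, $x\to_\phi y$ means that $\phi$ contains $x\mapsto\vec t$ with $y\in\vec t$, or $p(t_1,\dots,t_n)$ with $t_1=x$ and $t_i=y$ for some $i\in\mathit{out}(p)$. The sequent is an anti-axiom if it is not an axiom, $\xi$ contains no equation, $\zeta=\top$, and one of these holds: $\mathit{alloc}(\psi)\not\subseteq\mathit{alloc}(\phi)$; $\psi=\mathit{emp}\neq\phi$;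 some $x\in\mathit{alloc}(\phi)\setminus\mathit{alloc}(\psi)$ satisfies $y\not\to_\phi^* x$ for all $y\in\mathit{alloc}(\psi)$; $V\cap(\mathcal V(\phi)\setminus\mathcal V(\psi))\ne\emptyset$; $\mathcal V_{\mathtt{loc}}(\phi)\setminus(\mathcal V(\psi)\cup\mathit{alloc}(\phi))\neq\emptyset$. A sequent $\lambda\vdash^V\gamma$ is narrow if it contains no equation and $\mathcal V_{\mathtt{loc}}(\gamma)\setminus(V\cup\mathit{alloc}(\gamma))$ has at most $\mathit{width}(\mathfrak R)$ elements. **Proof trees.** A proof tree is a possibly infinite tree whose nodes are labeled by sequents, where the labels of the successors of each non-leaf node are the premises of an instance of an inference rule having the label of the node as its conclusion. It is fully expanded if all its leaves are labeled by axioms. Given a selection function (mapping every nonempty finite set of atoms, or of rule applications, to one of its elements), a proof tree is admissible if all its rule applications (with the notations above, $\gamma$ being the right-hand side of the conclusion) satisfy: 1. the conclusion is neither an axiom nor an anti-axiom, and no premise is an anti-axiom; 2. for $\mathtt I$: $\zeta=\top$ and $\psi=\mathit{emp}$; 3. for $\mathtt U$: $\gamma$ is a single spatial atom, with pure part $\top$,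 whose root is the first component of $\vec t$; 4. for $\mathtt C$: $\gamma$ is a single predicate atom with pure part $\top$, $x\in\mathit{alloc}(\phi)$, $y\in\mathcal V(\gamma)\setminus(\mathit{alloc}(\phi)\cup V)$, and $x\not\approx y$ does not occur in $\xi$; 5. for $\mathtt S$: $\xi_1=\xi_2$, $\zeta_1=\zeta_2=\top$, $\psi_1$ is the atom selected among the atoms of $\psi_1*\psi_2$; and if the conclusion is not narrow then the left premise is valid; 6. no rule of higher priority has an application on the same conclusion satisfying conditions 1–5, where the priorities are $\mathtt W>\mathtt V>\mathtt R>\mathtt E>\mathtt S>\mathtt U>\mathtt C>\mathtt I$; 7. for every rule other than $\mathtt S$, and for $\mathtt S$ if the conclusion is not narrow: the application is the one selected among all the applications of this rule on this conclusion that satisfy the conditions above (applications of $\mathtt U$ being considered up to the names of the fresh variables). **Theorem.** Let $\mathfrak R$ be a finite $\mathtt{loc}$-deterministic set of $\mathtt P$-rules. For every selection function, the root sequent of every (possibly infinite) fully expanded admissible proof tree is valid. -/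

import Mathlib

namespace SepLog

noncomputable section

open scoped Classical

universe u v w z

/-! ### Syntax -/

/-- A multisorted signature: sorts with a distinguished sort `loc`, constants (none of sort `loc`),
and predicate symbols. Every predicate symbol has a first argument of sort `loc`;
`profile p` lists the sorts of its remaining arguments. -/
structure Signature where
  Srt : Type u
  loc : Srt
  Const : Srt → Type v
  noLocConst : IsEmpty (Const loc)
  Pred : Type w
  profile : Pred → List Srt

variable {L : Signature.{u, v, w}}

/-- A variable is a pair (sort, name); there are countably many names for each sort. -/
abbrev Var (L : Signature.{u, v, w}) := L.Srt × ℕ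

/-- Terms of sort `k`. -/
inductive Term (L : Signature.{u, v, w}) (k : L.Srt) where
  | var (n : ℕ) : Term L k
  | con (c : L.Const k) : Term L k

/-- Terms of an arbitrary sort. -/
abbrev ATerm (L : Signature.{u, v, w}) := Σ k : L.Srt, Term L k

/-- As there are no constants of sort `loc`, a term of sort `loc` is a variable: its name. -/
def locName : Term L L.loc → ℕ
  | .var n => n
  | .con c => L.noLocConst.elim c

def Term.vars {k : L.Srt} : Term L k → Set (Var L)
  | .var n => {(k, n)}
  | .con _ => ∅

/-- Spatial atoms. Variables of sort `loc` are represented by their names. -/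
inductive Atom (L : Signature.{u, v, w}) where
  | pto (x : ℕ) (ts : List (ATerm L)) : Atom L
  | pred (p : L.Pred) (x : ℕ)
      (args : ∀ i : Fin (L.profile p).length, Term L ((L.profile p).get i)) : Atom L

def Atom.root : Atom L → ℕ
  | .pto x _ => x
  | .pred _ x _ => x

/-- The terms following the root. -/
def Atom.tail : Atom L → List (ATerm L)
  | .pto _ ts => ts
  | .pred p _ args => List.ofFn (fun i => (⟨(L.profile p).get i, args i⟩ : ATerm L))

/-- All the arguments, root included. -/
def Atom.full (a : Atom L) : List (ATerm L) := ⟨L.loc, .var a.root⟩ :: a.tail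

def Atom.vars (a : Atom L) : Set (Var L) := {x | ∃ t ∈ a.full, x ∈ t.2.vars}

def Atom.IsPred : Atom L → Prop
  | .pto _ _ => False
  | .pred _ _ _ => True

/-- Equations and disequations between terms of the same sort, modulo symmetry. -/
inductive Lit (L : Signature.{u, v, w}) where
  | eq (k : L.Srt) (e : Sym2 (Term L k)) : Lit L
  | ne (k : L.Srt) (e : Sym2 (Term L k)) : Lit L

def Lit.vars : Lit L → Set (Var L)
  | .eq _ e => {x | ∃ t ∈ e, x ∈ t.vars}
  | .ne _ e => {x | ∃ t ∈ e, x ∈ t.vars}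

def Lit.IsEq : Lit L → Prop
  | .eq _ _ => True
  | .ne _ _ => False

/-- Spatial formulas, modulo associativity and commutativity of `*` (`0` is `emp`). -/
abbrev Spatial (L : Signature.{u, v, w}) := Multiset (Atom L)

/-- Pure formulas, modulo associativity, commutativity and contraction (`∅` is `⊤`). -/
abbrev Pure (L : Signature.{u, v, w}) := Finset (Lit L)

@[ext] structure SymHeap (L : Signature.{u, v, w}) where
  sp : Spatial L
  pure : Pure L

def spVars (φ : Spatial L) : Set (Var L) := {x | ∃ a ∈ φ, x ∈ a.vars}

def pureVars (ξ : Pure L) : Set (Var L) := {x | ∃ l ∈ ξ, x ∈ l.vars}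

def SymHeap.vars (lam : SymHeap L) : Set (Var L) := spVars lam.sp ∪ pureVars lam.pure

/-- The multiset of variables allocated by a spatial formula, i.e. the roots of its atoms. -/
def alloc (φ : Spatial L) : Multiset ℕ := φ.map Atom.root

/-! ### Substitutions -/

/-- Sort-preserving substitutions. -/
abbrev Subst (L : Signature.{u, v, w}) := ∀ k : L.Srt, ℕ → Term L k

/-- The substitution replacing the variable `x` of sort `k` by `t`. -/
def Subst.single (k : L.Srt) (x : ℕ) (t : Term L k) : Subst L :=
  Function.update (fun _ n => Term.var n) k (Function.update (fun n => Term.var n) x t)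

def Term.subst (σ : Subst L) {k : L.Srt} : Term L k → Term L k
  | .var n => σ k n
  | .con c => .con c

def ATerm.subst (σ : Subst L) (t : ATerm L) : ATerm L := ⟨t.1, t.2.subst σ⟩

def Atom.subst (σ : Subst L) : Atom L → Atom L
  | .pto x ts => .pto (locName (σ L.loc x)) (ts.map (ATerm.subst σ))
  | .pred p x args => .pred p (locName (σ L.loc x)) (fun i => (args i).subst σ)

def Lit.subst (σ : Subst L) : Lit L → Lit L
  | .eq k e => .eq k (e.map (Term.subst σ))
  | .ne k e => .ne k (e.map (Term.subst σ))

def Spatial.subst (σ : Subst L) (φ : Spatial L) : Spatial L := Multiset.map (Atom.subst σ) φ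

def Pure.subst (σ : Subst L) (ξ : Pure L) : Pure L := Finset.image (Lit.subst σ) ξ

def SymHeap.subst (σ : Subst L) (lam : SymHeap L) : SymHeap L :=
  ⟨Spatial.subst σ lam.sp, Pure.subst σ lam.pure⟩

/-! ### Inductive rules -/

/-- An inductive rule `head(root, params) ⇐ body`, whose parameters are pairwise distinct. -/
structure IRule (L : Signature.{u, v, w}) where
  head : L.Pred
  root : ℕ
  params : Fin (L.profile head).length → ℕ
  body : SymHeap L
  distinct : ((L.loc, root) ::
    List.ofFn (fun i => ((L.profile head).get i, params i)) : List (Var L)).Nodup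

def IRule.headAtom (r : IRule L) : Atom L :=
  .pred r.head r.root (fun i => .var (r.params i))

/-- The existential variables of a rule. -/
def IRule.exVars (r : IRule L) : Set (Var L) := r.body.vars \ r.headAtom.vars

/-- `r.Unfolds a lam`: the symbolic heap `lam` is obtained from the body of `r` by renaming the
existential variables by pairwise distinct variables not occurring in the predicate atom `a`, and
replacing the parameters by the arguments of `a`. -/
def IRule.Unfolds (r : IRule L) (a : Atom L) (lam : SymHeap L) : Prop :=
  ∃ θ : Subst L,
    r.headAtom.subst θ = a ∧
    (∀ x ∈ r.exVars, ∃ m : ℕ, θ x.1 x.2 = .var m ∧ (x.1, m) ∉ a.vars) ∧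
    Set.InjOn (fun x : Var L => (⟨x.1, θ x.1 x.2⟩ : ATerm L)) r.exVars ∧
    lam = r.body.subst θ

/-- `P`-rules: `p(x₁,…,xₙ) ⇐ x₁ ↦ (y₁,…,y_k) * q₁(z₁,u₁) * … * q_m(z_m,u_m) ⋏ ξ`. -/
def IRule.IsPRule (r : IRule L) : Prop :=
  ∃ (ys : List (ATerm L)) (Q : Spatial L),
    r.body.sp = Atom.pto r.root ys ::ₘ Q ∧
    (∀ a ∈ Q, a.IsPred) ∧
    (∀ l ∈ r.body.pure, ∃ (k : L.Srt) (t t' : Term L k), l = .ne k s(t, t') ∧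
      ((⟨k, t⟩ : ATerm L) ∈ r.headAtom.full ∨ (⟨k, t⟩ : ATerm L) ∈ ys) ∧
      (⟨k, t'⟩ : ATerm L) ∈ ys ∧ (⟨k, t'⟩ : ATerm L) ∉ r.headAtom.full) ∧
    (∀ n : ℕ, n ∈ alloc Q ↔
      (⟨L.loc, .var n⟩ : ATerm L) ∈ ys ∧ (⟨L.loc, .var n⟩ : ATerm L) ∉ r.headAtom.full) ∧
    (alloc Q).Nodup ∧
    (∀ a ∈ Q, ∀ t ∈ a.tail, t ∈ r.headAtom.full ∨ t ∈ ys ∨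
      ∃ (k : L.Srt) (c : L.Const k), t = ⟨k, .con c⟩)

/-- `OutParam R p i`: the argument of index `i` of `p` (counting from `0`, the root) is in
`out_R(p)`. -/
inductive OutParam (R : Set (IRule L)) : L.Pred → ℕ → Prop
  | pto (r : IRule L) (hr : r ∈ R) (ts : List (ATerm L)) (ha : Atom.pto r.root ts ∈ r.body.sp)
      (i : ℕ) (t : Term L L.loc) (hi : r.headAtom.full[i]? = some ⟨L.loc, t⟩)
      (ht : (⟨L.loc, t⟩ : ATerm L) ∈ ts) : OutParam R r.head i
  | pred (r : IRule L) (hr : r ∈ R) (q : L.Pred) (x : ℕ)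
      (args : ∀ i : Fin (L.profile q).length, Term L ((L.profile q).get i))
      (ha : Atom.pred q x args ∈ r.body.sp)
      (i : ℕ) (t : Term L L.loc) (hi : r.headAtom.full[i]? = some ⟨L.loc, t⟩)
      (j : ℕ) (hj : OutParam R q j)
      (ht : (Atom.pred q x args).full[j]? = some ⟨L.loc, t⟩) : OutParam R r.head i

/-- The edge relation between variables of sort `loc` induced by a spatial formula. -/
def Edge (R : Set (IRule L)) (φ : Spatial L) (x y : ℕ) : Prop :=
  (∃ ts : List (ATerm L), Atom.pto x ts ∈ φ ∧ (⟨L.loc, .var y⟩ : ATerm L) ∈ ts) ∨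
  (∃ (p : L.Pred) (args : ∀ i : Fin (L.profile p).length, Term L ((L.profile p).get i)) (i : ℕ),
    Atom.pred p x args ∈ φ ∧ OutParam R p i ∧
    (Atom.pred p x args).full[i]? = some ⟨L.loc, .var y⟩)

/-- The maximum of the arities of the predicate symbols occurring in `R` and of the lengths of the
records occurring in `R`. -/
def width (R : Set (IRule L)) : ℕ :=
  sSup {n | ∃ r ∈ R, n = r.headAtom.full.length ∨
    ∃ a ∈ r.body.sp, (a.IsPred ∧ n = a.full.length) ∨ (¬ a.IsPred ∧ n = a.tail.length)}

/-! ### Semantics -/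

/-- The fixed universe: a countably infinite set for each sort, and the value of the constants. -/
structure Universe (L : Signature.{u, v, w}) where
  Dom : L.Srt → Type z
  infinite : ∀ k, Infinite (Dom k)
  countable : ∀ k, Countable (Dom k)
  cval : ∀ k, L.Const k → Dom k
  cval_injective : ∀ k, Function.Injective (cval k)

variable {M : Universe.{u, v, w, z} L}

abbrev Value (M : Universe.{u, v, w, z} L) := Σ k : L.Srt, M.Dom k

abbrev Store (M : Universe.{u, v, w, z} L) := ∀ k : L.Srt, ℕ → M.Dom k

def Store.eval (s : Store M) {k : L.Srt} : Term L k → M.Dom k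
  | .var n => s k n
  | .con c => M.cval k c

def Store.evalA (s : Store M) (t : ATerm L) : Value M := ⟨t.1, Store.eval s t.2⟩

/-- Heaps: finite partial functions from locations to tuples of values. -/
@[ext] structure Heap (M : Universe.{u, v, w, z} L) where
  map : M.Dom L.loc → Option (List (Value M))
  finite : {l | map l ≠ none}.Finite

def Heap.dom (h : Heap M) : Set (M.Dom L.loc) := {l | h.map l ≠ none}

/-- `h` is the union of the disjoint heaps `h₁` and `h₂`. -/
def Heap.IsDisjointUnion (h h₁ h₂ : Heap M) : Prop :=
  ∀ l, (h₁.map l = none ∧ h.map l = h₂.map l) ∨ (h₂.map l = none ∧ h.map l = h₁.map l)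

/-- `h = {(l, vs)}`. -/
def Heap.IsSingleton (h : Heap M) (l : M.Dom L.loc) (vs : List (Value M)) : Prop :=
  h.map l = some vs ∧ ∀ l', l' ≠ l → h.map l' = none

def Store.SatLit (s : Store M) : Lit L → Prop
  | .eq _ e => (e.map (Store.eval s)).IsDiag
  | .ne _ e => ¬ (e.map (Store.eval s)).IsDiag

def Store.SatPure (s : Store M) (ξ : Pure L) : Prop := ∀ l ∈ ξ, Store.SatLit s l

/-- Satisfaction of spatial formulas modulo the rules `R`. -/
inductive SatSp (M : Universe.{u, v, w, z} L) (R : Set (IRule L)) :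
    Store M → Heap M → Spatial L → Prop
  | emp (s : Store M) (h : Heap M) (he : ∀ l, h.map l = none) : SatSp M R s h 0
  | pto (s : Store M) (h : Heap M) (x : ℕ) (ts : List (ATerm L))
      (hs : h.IsSingleton (s L.loc x) (ts.map (Store.evalA s))) : SatSp M R s h {Atom.pto x ts}
  | sep (s : Store M) (h h₁ h₂ : Heap M) (φ₁ φ₂ : Spatial L) (hu : h.IsDisjointUnion h₁ h₂)
      (h₁s : SatSp M R s h₁ φ₁) (h₂s : SatSp M R s h₂ φ₂) : SatSp M R s h (φ₁ + φ₂)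
  | pred (s s' : Store M) (h : Heap M) (p : L.Pred) (x : ℕ)
      (args : ∀ i : Fin (L.profile p).length, Term L ((L.profile p).get i))
      (r : IRule L) (hr : r ∈ R) (lam : SymHeap L) (hu : r.Unfolds (Atom.pred p x args) lam)
      (hs' : ∀ y : Var L, y ∉ lam.vars \ (Atom.pred p x args).vars → s' y.1 y.2 = s y.1 y.2)
      (hp : Store.SatPure s' lam.pure) (hsp : SatSp M R s' h lam.sp) :
      SatSp M R s h {Atom.pred p x args}

def Sat (M : Universe.{u, v, w, z} L) (R : Set (IRule L)) (s : Store M) (h : Heap M)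
    (lam : SymHeap L) : Prop :=
  SatSp M R s h lam.sp ∧ Store.SatPure s lam.pure

/-- Deterministic sets of rules. The two stores interpret the variables of the two rules, which are
assumed to be disjoint after renaming. -/
def Deterministic (M : Universe.{u, v, w, z} L) (R : Set (IRule L)) : Prop :=
  ∀ r₁ ∈ R, ∀ r₂ ∈ R, r₁ ≠ r₂ → r₁.head = r₂.head →
    ∀ (y₁ y₂ : ℕ) (t₁ t₂ : List (ATerm L)) (φ₁ φ₂ : Spatial L),
      r₁.body.sp = Atom.pto y₁ t₁ ::ₘ φ₁ → r₂.body.sp = Atom.pto y₂ t₂ ::ₘ φ₂ →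
      ¬ ∃ s₁ s₂ : Store M,
        r₁.headAtom.full.map (Store.evalA s₁) = r₂.headAtom.full.map (Store.evalA s₂) ∧
        t₁.map (Store.evalA s₁) = t₂.map (Store.evalA s₂) ∧
        Store.SatPure s₁ r₁.body.pure ∧ Store.SatPure s₂ r₂.body.pure

def LocDeterministic (M : Universe.{u, v, w, z} L) (R : Set (IRule L)) : Prop :=
  Deterministic M R ∧
    ∀ r ∈ R, ∀ (k : L.Srt) (e : Sym2 (Term L k)), Lit.ne k e ∈ r.body.pure →
      ∃ x y : ℕ, Lit.ne k e = Lit.ne L.loc s(.var x, .var y)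

/-! ### Sequents -/

/-- The sequent `lhs ⊢ rhs` with multiset `nal` of (non-allocated) variables of sort `loc`. -/
@[ext] structure Sequent (L : Signature.{u, v, w}) where
  lhs : SymHeap L
  rhs : SymHeap L
  nal : Multiset ℕ

def Sequent.vars (Q : Sequent L) : Set (Var L) :=
  Q.lhs.vars ∪ Q.rhs.vars ∪ {x | x.1 = L.loc ∧ x.2 ∈ Q.nal}

def Sequent.subst (σ : Subst L) (Q : Sequent L) : Sequent L :=
  ⟨Q.lhs.subst σ, Q.rhs.subst σ, Q.nal.map (fun n => locName (σ L.loc n))⟩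

def Sequent.IsCounterModel (M : Universe.{u, v, w, z} L) (R : Set (IRule L)) (Q : Sequent L)
    (s : Store M) (h : Heap M) : Prop :=
  Sat M R s h Q.lhs ∧ ¬ Sat M R s h Q.rhs ∧
  (∀ x ∈ Q.nal, s L.loc x ∉ h.dom) ∧
  (∀ x y : ℕ, ({x, y} : Multiset ℕ) ≤ Q.nal → s L.loc x ≠ s L.loc y)

def Sequent.IsValid (M : Universe.{u, v, w, z} L) (R : Set (IRule L)) (Q : Sequent L) : Prop :=
  ∀ (s : Store M) (h : Heap M), ¬ Q.IsCounterModel M R s h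

def Sequent.EqualityFree (Q : Sequent L) : Prop :=
  (∀ l ∈ Q.lhs.pure, ¬ l.IsEq) ∧ ∀ l ∈ Q.rhs.pure, ¬ l.IsEq

/-- The restricted entailment relation `lam ▷_V ξ`. -/
def Entails (lam : SymHeap L) (V : Multiset ℕ) (ξ : Pure L) : Prop :=
  ∀ l ∈ ξ,
    l ∈ lam.pure ∨
    (∃ (k : L.Srt) (n : ℕ), l = .eq k s(.var n, .var n)) ∨
    (∃ (k : L.Srt) (c d : L.Const k), c ≠ d ∧ l = .ne k s(.con c, .con d)) ∨
    (∃ x y : ℕ, l = .ne L.loc s(.var x, .var y) ∧ ({x, y} : Multiset ℕ) ≤ alloc lam.sp + V)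

def Sequent.IsAxiom (Q : Sequent L) : Prop :=
  (Q.lhs.sp = Q.rhs.sp ∧ Q.rhs.pure ⊆ Q.lhs.pure) ∨
  (∃ (k : L.Srt) (t : Term L k), Lit.ne k s(t, t) ∈ Q.lhs.pure) ∨
  (¬ (alloc Q.lhs.sp).Nodup) ∨
  (∃ x ∈ alloc Q.lhs.sp, x ∈ Q.nal) ∨
  (¬ Q.nal.Nodup)

def Sequent.IsAntiAxiom (R : Set (IRule L)) (Q : Sequent L) : Prop :=
  ¬ Q.IsAxiom ∧ (∀ l ∈ Q.lhs.pure, ¬ l.IsEq) ∧ Q.rhs.pure = ∅ ∧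
  ((∃ x ∈ alloc Q.rhs.sp, x ∉ alloc Q.lhs.sp) ∨
   (Q.rhs.sp = 0 ∧ Q.lhs.sp ≠ 0) ∨
   (∃ x ∈ alloc Q.lhs.sp, x ∉ alloc Q.rhs.sp ∧
      ∀ y ∈ alloc Q.rhs.sp, ¬ Relation.ReflTransGen (Edge R Q.lhs.sp) y x) ∨
   (∃ x ∈ Q.nal, (L.loc, x) ∈ spVars Q.lhs.sp ∧ (L.loc, x) ∉ spVars Q.rhs.sp) ∨
   (∃ x : ℕ, (L.loc, x) ∈ spVars Q.lhs.sp ∧ (L.loc, x) ∉ spVars Q.rhs.sp ∧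
      x ∉ alloc Q.lhs.sp))

/-- Narrow sequents. -/
def Sequent.Narrow (R : Set (IRule L)) (Q : Sequent L) : Prop :=
  Q.EqualityFree ∧
  {x : ℕ | (L.loc, x) ∈ Q.rhs.vars ∧ x ∉ Q.nal ∧ x ∉ alloc Q.rhs.sp}.encard ≤ (width R : ℕ∞)

/-! ### Inference rules -/

/-- The data identifying an application of one of the inference rules on a given sequent
(for `U`, up to the names of the fresh variables). -/
inductive App (L : Signature.{u, v, w}) where
  | R (k : L.Srt) (x : ℕ) (t : Term L k) : App L
  | E (ζ' : Pure L) : App L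
  | S (left right : SymHeap L × SymHeap L) : App L
  | U (a : Atom L) : App L
  | I (x : ℕ) (ys : List (ATerm L)) (a : Atom L) (r : IRule L) : App L
  | W (ξ' : Pure L) : App L
  | C (x y : ℕ) : App L
  | V (x : ℕ) : App L

/-- `Step R Q a prems`: the rule application `a` derives the conclusion `Q` from the premises
`prems`. In `R`, `E`, `W`, the deleted literals are really deleted: they do not occur in
the remaining formula, and there is at least one of them. -/
inductive Step (R : Set (IRule L)) : Sequent L → App L → List (Sequent L) → Prop
  | replacement (φ : Spatial L) (ξ : Pure L) (γ : SymHeap L) (V : Multiset ℕ)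
      (k : L.Srt) (x : ℕ) (t : Term L k) (hx : Lit.eq k s(.var x, t) ∉ ξ) :
      Step R ⟨⟨φ, insert (Lit.eq k s(.var x, t)) ξ⟩, γ, V⟩ (.R k x t)
        [Sequent.subst (Subst.single k x t) ⟨⟨φ, ξ⟩, γ, V⟩]
  | elimination (lam : SymHeap L) (ψ : Spatial L) (ζ ζ' : Pure L) (V : Multiset ℕ)
      (hd : Disjoint ζ ζ') (hne : ζ'.Nonempty) (he : Entails lam V ζ') :
      Step R ⟨lam, ⟨ψ, ζ ∪ ζ'⟩, V⟩ (.E ζ') [⟨lam, ⟨ψ, ζ⟩, V⟩]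
  | separation (φ₁ φ₂ ψ₁ ψ₂ : Spatial L) (ξ₁ ξ₂ ζ₁ ζ₂ : Pure L) (V : Multiset ℕ)
      (h₁ : φ₁ ≠ 0) (h₂ : φ₂ ≠ 0) :
      Step R ⟨⟨φ₁ + φ₂, ξ₁ ∪ ξ₂⟩, ⟨ψ₁ + ψ₂, ζ₁ ∪ ζ₂⟩, V⟩
        (.S (⟨φ₁, ξ₁⟩, ⟨ψ₁, ζ₁⟩) (⟨φ₂, ξ₂⟩, ⟨ψ₂, ζ₂⟩))
        [⟨⟨φ₁, ξ₁⟩, ⟨ψ₁, ζ₁⟩, V + alloc φ₂⟩, ⟨⟨φ₂, ξ₂⟩, ⟨ψ₂, ζ₂⟩, V + alloc φ₁⟩]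
  | unfolding (p : L.Pred) (x : ℕ)
      (args : ∀ i : Fin (L.profile p).length, Term L ((L.profile p).get i))
      (φ : Spatial L) (ξ : Pure L) (γ : SymHeap L) (V : Multiset ℕ)
      (rs : List (IRule L)) (hnd : rs.Nodup) (hrs : ∀ r, r ∈ rs ↔ r ∈ R ∧ r.head = p)
      (prems : List (Sequent L))
      (hp : List.Forall₂ (fun (r : IRule L) (Q' : Sequent L) =>
        ∃ lam : SymHeap L, r.Unfolds (Atom.pred p x args) lam ∧
          (∀ y ∈ lam.vars, y ∉ (Atom.pred p x args).vars →
            y ∉ Sequent.vars ⟨⟨Atom.pred p x args ::ₘ φ, ξ⟩, γ, V⟩) ∧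
          Q' = ⟨⟨lam.sp + φ, lam.pure ∪ ξ⟩, γ, V⟩) rs prems) :
      Step R ⟨⟨Atom.pred p x args ::ₘ φ, ξ⟩, γ, V⟩ (.U (Atom.pred p x args)) prems
  | imitation (x : ℕ) (ys : List (ATerm L)) (φ : Spatial L) (ξ : Pure L)
      (p : L.Pred) (args : ∀ i : Fin (L.profile p).length, Term L ((L.profile p).get i))
      (ψ : Spatial L) (ζ : Pure L) (V : Multiset ℕ)
      (r : IRule L) (hr : r ∈ R) (us : List (ATerm L)) (ψ' : Spatial L) (ζ' : Pure L)
      (hu : r.Unfolds (Atom.pred p x args) ⟨Atom.pto x us ::ₘ ψ', ζ'⟩)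
      (σ : Subst L)
      (hdom : ∀ y : Var L, σ y.1 y.2 ≠ .var y.2 →
        (⟨y.1, .var y.2⟩ : ATerm L) ∈ us ∧ y ∉ (Atom.pred p x args).vars)
      (hσ : us.map (ATerm.subst σ) = ys)
      (he : Entails ⟨Atom.pto x ys ::ₘ φ, ξ⟩ V (Pure.subst σ ζ')) :
      Step R ⟨⟨Atom.pto x ys ::ₘ φ, ξ⟩, ⟨Atom.pred p x args ::ₘ ψ, ζ⟩, V⟩
        (.I x ys (Atom.pred p x args) r)
        [⟨⟨Atom.pto x ys ::ₘ φ, ξ⟩, ⟨Atom.pto x ys ::ₘ (Spatial.subst σ ψ' + ψ), ζ⟩, V⟩]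
  | weakening (φ : Spatial L) (ξ ξ' : Pure L) (γ : SymHeap L) (V : Multiset ℕ)
      (hd : Disjoint ξ ξ') (hne : ξ'.Nonempty)
      (hw : (∃ (k : L.Srt) (t t' : Term L k), ξ' = {Lit.ne k s(t, t')} ∧ Entails ⟨φ, ∅⟩ V ξ') ∨
        (∃ (k : L.Srt) (x : ℕ),
          (k, x) ∉ spVars φ ∧ (k, x) ∉ pureVars ξ ∧ (k, x) ∉ γ.vars ∧
          ∀ l ∈ ξ', ∃ t : Term L k, t ≠ .var x ∧ l = .ne k s(.var x, t))) :
      Step R ⟨⟨φ, ξ ∪ ξ'⟩, γ, V⟩ (.W ξ') [⟨⟨φ, ξ⟩, γ, V⟩]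
  | caseSplit (φ : Spatial L) (ξ : Pure L) (γ : SymHeap L) (V : Multiset ℕ) (x y : ℕ) :
      Step R ⟨⟨φ, ξ⟩, γ, V⟩ (.C x y)
        [Sequent.subst (Subst.single L.loc x (.var y)) ⟨⟨φ, ξ⟩, γ, V⟩,
         ⟨⟨φ, insert (Lit.ne L.loc s(.var x, .var y)) ξ⟩, γ, V⟩]
  | varWeakening (lam γ : SymHeap L) (V : Multiset ℕ) (x : ℕ)
      (hl : (L.loc, x) ∉ lam.vars) (hr : (L.loc, x) ∉ γ.vars) :
      Step R ⟨lam, γ, x ::ₘ V⟩ (.V x) [⟨lam, γ, V⟩]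

/-! ### The strategy -/

/-- The priority of the rules: `W > V > R > E > S > U > C > I`. Distinct rules have distinct
priorities, so that two applications with the same priority are applications of the same rule. -/
def App.priority : App L → ℕ
  | .W _ => 8
  | .V _ => 7
  | .R _ _ _ => 6
  | .E _ => 5
  | .S _ _ => 4
  | .U _ => 3
  | .C _ _ => 2
  | .I _ _ _ _ => 1

def App.IsS : App L → Prop
  | .S _ _ => True
  | _ => False

/-- A selection function, on finite nonempty sets of atoms and of rule applications
(a rule application being given together with its conclusion). -/
structure Selection (L : Signature.{u, v, w}) where
  atom : Set (Atom L) → Atom L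
  atom_mem : ∀ A : Set (Atom L), A.Finite → A.Nonempty → atom A ∈ A
  app : Set (Sequent L × App L) → Sequent L × App L
  app_mem : ∀ A : Set (Sequent L × App L), A.Finite → A.Nonempty → app A ∈ A

/-- The restrictions that the strategy puts on each rule. -/
def SideCondition (M : Universe.{u, v, w, z} L) (R : Set (IRule L)) (sel : Selection L)
    (Q : Sequent L) : App L → Prop
  | .I _ _ a _ => Q.rhs.pure = ∅ ∧ Q.rhs.sp = {a}
  | .U a => Q.rhs.pure = ∅ ∧ ∃ b : Atom L, Q.rhs.sp = {b} ∧ b.root = a.root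
  | .C x y => Q.rhs.pure = ∅ ∧ x ∈ alloc Q.lhs.sp ∧
      (L.loc, y) ∈ Q.rhs.vars ∧ y ∉ alloc Q.lhs.sp ∧ y ∉ Q.nal ∧
      (∃ b : Atom L, b.IsPred ∧ Q.rhs.sp = {b}) ∧
      Lit.ne L.loc s(.var x, .var y) ∉ Q.lhs.pure
  | .S left right => left.1.pure = right.1.pure ∧ left.2.pure = ∅ ∧ right.2.pure = ∅ ∧
      left.2.sp = {sel.atom {b | b ∈ Q.rhs.sp}} ∧
      (¬ Q.Narrow R →
        Sequent.IsValid M R ⟨left.1, left.2, Q.nal + alloc right.1.sp⟩)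
  | _ => True

/-- The rule application `a` on `Q`, with premises `prems`, fulfills all the conditions of the
strategy other than those about priorities and selected applications. -/
def Allowed (M : Universe.{u, v, w, z} L) (R : Set (IRule L)) (sel : Selection L)
    (Q : Sequent L) (a : App L) (prems : List (Sequent L)) : Prop :=
  Step R Q a prems ∧ ¬ Q.IsAxiom ∧ ¬ Q.IsAntiAxiom R ∧ (∀ Q' ∈ prems, ¬ Q'.IsAntiAxiom R) ∧
  SideCondition M R sel Q a

/-- The rule application `a` on `Q`, with premises `prems`, fulfills all the conditions of the
strategy. -/
def AdmissibleStep (M : Universe.{u, v, w, z} L) (R : Set (IRule L)) (sel : Selection L)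
    (Q : Sequent L) (a : App L) (prems : List (Sequent L)) : Prop :=
  Allowed M R sel Q a prems ∧
  (∀ (b : App L) (prems' : List (Sequent L)), Allowed M R sel Q b prems' →
    b.priority ≤ a.priority) ∧
  (¬ a.IsS ∨ ¬ Q.Narrow R →
    (Q, a) = sel.app {c | c.1 = Q ∧ c.2.priority = a.priority ∧
      ∃ prems' : List (Sequent L), Allowed M R sel Q c.2 prems'})

/-! ### Proof trees -/

/-- A (possibly infinite) proof tree. Nodes are positions in `ℕ*`; the position `π ++ [i]` is the
`i`-th successor of `π`. Every node is labeled by a sequent, and the sequents labeling the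
successors of a node that is not a leaf are the premises of a rule application, recorded in `app`,
with the label of the node as its conclusion. -/
structure ProofTree (R : Set (IRule L)) where
  nodes : Set (List ℕ)
  label : List ℕ → Sequent L
  app : List ℕ → App L
  root_mem : [] ∈ nodes
  parent_mem : ∀ (π : List ℕ) (i : ℕ), π ++ [i] ∈ nodes → π ∈ nodes
  step : ∀ π ∈ nodes, (∃ i, π ++ [i] ∈ nodes) →
    ∃ prems : List (Sequent L), Step R (label π) (app π) prems ∧
      ∀ i : ℕ, (π ++ [i] ∈ nodes ↔ i < prems.length) ∧
        (π ++ [i] ∈ nodes → prems[i]? = some (label (π ++ [i])))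

variable {R : Set (IRule L)}

def ProofTree.root (T : ProofTree R) : Sequent L := T.label []

def ProofTree.IsLeaf (T : ProofTree R) (π : List ℕ) : Prop :=
  π ∈ T.nodes ∧ ∀ i : ℕ, π ++ [i] ∉ T.nodes

def ProofTree.FullyExpanded (T : ProofTree R) : Prop :=
  ∀ π : List ℕ, T.IsLeaf π → (T.label π).IsAxiom

def ProofTree.Admissible (M : Universe.{u, v, w, z} L) (sel : Selection L)
    (T : ProofTree R) : Prop :=
  ∀ π ∈ T.nodes, ∀ prems : List (Sequent L), prems ≠ [] →
    (∀ i : ℕ, (π ++ [i] ∈ T.nodes ↔ i < prems.length) ∧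
      (π ++ [i] ∈ T.nodes → prems[i]? = some (T.label (π ++ [i])))) →
    AdmissibleStep M R sel (T.label π) (T.app π) prems

end

end SepLog

/-!
Suppose that the root of a fully expanded admissible proof tree has a counter-model. Every
inference rule is locally sound in the following strong sense: a counter-model `(s, h)` of the
conclusion of a rule application yields a counter-model `(s', h')` of one of the premises, where
`h'` is a part of `h`. As axioms have no counter-model, this produces an infinite branch of sequents
with counter-models. The conditions of the strategy forbid such a branch, because the pair formed by
the sequent and the heap decreases at each step for a lexicographic order with the following
components (`Sequent.rank`):

* the size of the heap, which decreases with `S`, since every spatial atom allocates its root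
  (`SatSp.roots`; this is where the shape of the rules matters);
* the total number of equations on the left, literals on the right, locations of the heap not
  described by a points-to atom on the left, plus `1` if there is no points-to atom on the right:
  it decreases with `R`, `E`, `U` and `I`; for `I`, because the strategy requires the right-hand
  side to be a single predicate atom, so that `I` applies at most once between two `S`;
* the number of `loc`-variables of the spatial parts, which decreases in the left premise of `C`;
* the number of pairs on which `C` may still be applied, which decreases in the right premise of
  `C`, and which `W` and `V` do not increase (`undecided_weakening_subset`);
* the number of literals on the left plus the number of non-allocated variables, which decreases
  with `W` and `V`.

The local soundness of `U` and `I` rests on `SatSp.transfer`: satisfaction of a spatial formula only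
depends on the values of the terms occurring in its atoms. It shows that satisfaction commutes with
substitutions (`sat_subst`) and that existential variables may be renamed at will. The descent is
`Step.exists_smaller_counterModel`.
-/

namespace SepLog

noncomputable section

open scoped Classical

universe u v w z

variable {L : Signature.{u, v, w}} {M : Universe.{u, v, w, z} L} {R : Set (IRule L)}

/-! ### Ground atoms and substitutions -/

/-- An atom whose terms have been replaced by their values. -/
inductive GroundAtom (M : Universe.{u, v, w, z} L) where
  | pto (l : M.Dom L.loc) (vs : List (Value M)) : GroundAtom M
  | pred (p : L.Pred) (l : M.Dom L.loc)
      (args : ∀ i : Fin (L.profile p).length, M.Dom ((L.profile p).get i)) : GroundAtom M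

/-- The ground instance of an atom in a store. -/
def Store.ground (s : Store M) : Atom L → GroundAtom M
  | .pto x ts => .pto (s L.loc x) (ts.map s.evalA)
  | .pred p x args => .pred p (s L.loc x) (fun i => s.eval (args i))

/-- The store mapping each variable `x` to the value of `σ x`. -/
def Store.comp (s : Store M) (σ : Subst L) : Store M := fun k n => s.eval (σ k n)

theorem Store.apply_locName (s : Store M) (t : Term L L.loc) :
    s L.loc (locName t) = s.eval t := by
  cases t with
  | var n => rfl
  | con c => exact L.noLocConst.elim c

theorem Store.eval_subst (s : Store M) (σ : Subst L) {k : L.Srt} (t : Term L k) :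
    s.eval (t.subst σ) = (s.comp σ).eval t := by
  cases t <;> rfl

theorem Store.evalA_subst (s : Store M) (σ : Subst L) (t : ATerm L) :
    s.evalA (t.subst σ) = (s.comp σ).evalA t := by
  simp only [Store.evalA, ATerm.subst, Store.eval_subst]

theorem Store.ground_subst (s : Store M) (σ : Subst L) (a : Atom L) :
    s.ground (a.subst σ) = (s.comp σ).ground a := by
  cases a with
  | pto x ts =>
    simp only [Atom.subst, Store.ground, Store.apply_locName, List.map_map]
    congr 1
    exact List.map_congr_left fun t _ => s.evalA_subst σ t
  | pred p x args =>
    simp only [Atom.subst, Store.ground, Store.apply_locName, Store.eval_subst]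
    rfl

theorem Store.map_ground_subst (s : Store M) (σ : Subst L) (φ : Spatial L) :
    (Spatial.subst σ φ).map s.ground = φ.map (s.comp σ).ground := by
  rw [Spatial.subst, Multiset.map_map]
  exact Multiset.map_congr rfl fun a _ => s.ground_subst σ a

theorem Store.satLit_subst (s : Store M) (σ : Subst L) (l : Lit L) :
    s.SatLit (l.subst σ) ↔ (s.comp σ).SatLit l := by
  have h : ∀ k : L.Srt, (Store.eval s (k := k)) ∘ (Term.subst σ) = Store.eval (s.comp σ) :=
    fun k => funext fun t => s.eval_subst σ t
  cases l <;> simp only [Lit.subst, Store.SatLit, Sym2.map_map, h]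

theorem Store.satPure_subst (s : Store M) (σ : Subst L) (ξ : Pure L) :
    s.SatPure (Pure.subst σ ξ) ↔ (s.comp σ).SatPure ξ := by
  simp [Store.SatPure, Pure.subst, Store.satLit_subst]

theorem Store.eval_congr {s s' : Store M} {k : L.Srt} {t : Term L k}
    (h : ∀ x ∈ t.vars, s x.1 x.2 = s' x.1 x.2) : s.eval t = s'.eval t := by
  cases t with
  | var n => exact h (k, n) rfl
  | con c => rfl

theorem Store.agree_of_eval_eq {s s' : Store M} {k : L.Srt} {t : Term L k}
    (h : s.eval t = s'.eval t) {x : Var L} (hx : x ∈ t.vars) : s x.1 x.2 = s' x.1 x.2 := by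
  cases t with
  | var n => cases hx; exact h
  | con c => exact hx.elim

theorem Store.satLit_congr {s s' : Store M} {l : Lit L}
    (h : ∀ x ∈ l.vars, s x.1 x.2 = s' x.1 x.2) : s.SatLit l ↔ s'.SatLit l := by
  cases l with
  | eq k e | ne k e =>
    have : e.map s.eval = e.map s'.eval :=
      Sym2.map_congr fun t ht => Store.eval_congr fun x hx => h x ⟨t, ht, hx⟩
    simp only [Store.SatLit, this]

theorem Store.satPure_congr {s s' : Store M} {ξ : Pure L}
    (h : ∀ x ∈ pureVars ξ, s x.1 x.2 = s' x.1 x.2) : s.SatPure ξ ↔ s'.SatPure ξ :=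
  forall₂_congr fun l hl => Store.satLit_congr fun x hx => h x ⟨l, hl, hx⟩

theorem Atom.root_mem_vars (a : Atom L) : (L.loc, a.root) ∈ a.vars :=
  ⟨_, List.mem_cons_self, rfl⟩

theorem Atom.mem_vars {a : Atom L} {x : Var L} :
    x ∈ a.vars ↔ x = (L.loc, a.root) ∨ ∃ t ∈ a.tail, x ∈ t.2.vars := by
  simp [Atom.vars, Atom.full, Term.vars]

theorem Store.ground_eq_iff {s s' : Store M} {a : Atom L} :
    s.ground a = s'.ground a ↔ ∀ x ∈ a.vars, s x.1 x.2 = s' x.1 x.2 := by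
  constructor
  · intro h x hx
    cases a with
    | pto y ts =>
      simp only [Store.ground, GroundAtom.pto.injEq] at h
      rcases Atom.mem_vars.1 hx with rfl | ⟨t, ht, hxt⟩
      · exact h.1
      · have := List.map_inj_left.1 h.2 t ht
        simp only [Store.evalA, Sigma.mk.injEq, heq_eq_eq, true_and] at this
        exact Store.agree_of_eval_eq this hxt
    | pred p y args =>
      simp only [Store.ground, GroundAtom.pred.injEq, heq_eq_eq, true_and] at h
      rcases Atom.mem_vars.1 hx with rfl | ⟨t, ht, hxt⟩
      · exact h.1
      · obtain ⟨i, rfl⟩ := (List.mem_ofFn' _ _).1 ht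
        exact Store.agree_of_eval_eq (congrFun h.2 i) hxt
  · intro h
    cases a with
    | pto y ts =>
      simp only [Store.ground, GroundAtom.pto.injEq]
      refine ⟨h _ (Atom.root_mem_vars _), List.map_congr_left fun t ht => ?_⟩
      simp only [Store.evalA]
      rw [Store.eval_congr fun x hx => h x (Atom.mem_vars.2 (.inr ⟨t, ht, hx⟩))]
    | pred p y args =>
      simp only [Store.ground, GroundAtom.pred.injEq, heq_eq_eq, true_and]
      refine ⟨h _ (Atom.root_mem_vars _), funext fun i => Store.eval_congr fun x hx =>
        h x (Atom.mem_vars.2 (.inr ⟨⟨_, args i⟩, (List.mem_ofFn' _ _).2 ⟨i, rfl⟩, hx⟩))⟩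

theorem Store.map_ground_congr {s s' : Store M} {φ : Spatial L}
    (h : ∀ x ∈ spVars φ, s x.1 x.2 = s' x.1 x.2) : φ.map s.ground = φ.map s'.ground :=
  Multiset.map_congr rfl fun a ha => Store.ground_eq_iff.2 fun x hx => h x ⟨a, ha, hx⟩

theorem Term.mem_vars_subst {σ : Subst L} {k : L.Srt} {t : Term L k} {y : Var L} :
    y ∈ (t.subst σ).vars ↔ ∃ x ∈ t.vars, y ∈ (σ x.1 x.2).vars := by
  cases t <;> simp [Term.subst, Term.vars]

theorem vars_eq_singleton_locName (t : Term L L.loc) : t.vars = {(L.loc, locName t)} := by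
  cases t with
  | var n => rfl
  | con c => exact L.noLocConst.elim c

theorem Atom.root_subst (σ : Subst L) (a : Atom L) :
    (a.subst σ).root = locName (σ L.loc a.root) := by
  cases a <;> rfl

theorem Atom.tail_subst (σ : Subst L) (a : Atom L) :
    (a.subst σ).tail = a.tail.map (ATerm.subst σ) := by
  cases a with
  | pto x ts => rfl
  | pred p x args =>
    simp only [Atom.subst, Atom.tail, List.map_ofFn]
    rfl

theorem Atom.isPred_subst {σ : Subst L} {a : Atom L} : (a.subst σ).IsPred ↔ a.IsPred := by
  cases a <;> rfl

theorem Atom.mem_vars_subst {σ : Subst L} {a : Atom L} {y : Var L} :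
    y ∈ (a.subst σ).vars ↔ ∃ x ∈ a.vars, y ∈ (σ x.1 x.2).vars := by
  have hr : (y = (L.loc, locName (σ L.loc a.root))) ↔ y ∈ (σ L.loc a.root).vars := by
    rw [vars_eq_singleton_locName]; rfl
  rw [Atom.mem_vars, Atom.root_subst, Atom.tail_subst, hr]
  simp only [List.mem_map, exists_exists_and_eq_and, ATerm.subst, Term.mem_vars_subst,
    Atom.mem_vars]
  constructor
  · rintro (h | ⟨t, ht, x, hx, hy⟩)
    · exact ⟨_, .inl rfl, h⟩
    · exact ⟨x, .inr ⟨t, ht, hx⟩, hy⟩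
  · rintro ⟨x, rfl | ⟨t, ht, hx⟩, hy⟩
    · exact .inl hy
    · exact .inr ⟨t, ht, x, hx, hy⟩

theorem mem_spVars_subst {σ : Subst L} {φ : Spatial L} {y : Var L} :
    y ∈ spVars (Spatial.subst σ φ) ↔ ∃ x ∈ spVars φ, y ∈ (σ x.1 x.2).vars := by
  simp only [spVars, Spatial.subst, Multiset.mem_map, exists_exists_and_eq_and,
    Set.mem_ofPred_eq, Atom.mem_vars_subst]
  constructor
  · rintro ⟨a, ha, x, hx, hy⟩
    exact ⟨x, ⟨a, ha, hx⟩, hy⟩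
  · rintro ⟨x, ⟨a, ha, hx⟩, hy⟩
    exact ⟨a, ha, x, hx, hy⟩

theorem SymHeap.mem_vars_subst {σ : Subst L} {lam : SymHeap L} {x y : Var L}
    (hx : x ∈ lam.vars) (hy : y ∈ (σ x.1 x.2).vars) : y ∈ (lam.subst σ).vars := by
  rcases hx with hx | ⟨l, hl, hx⟩
  · exact .inl (mem_spVars_subst.2 ⟨x, hx, hy⟩)
  · refine .inr ⟨l.subst σ, Finset.mem_image_of_mem _ hl, ?_⟩
    cases l with
    | eq k e | ne k e =>
      obtain ⟨t, ht, hxt⟩ := hx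
      exact ⟨t.subst σ, Sym2.mem_map.2 ⟨t, ht, rfl⟩, Term.mem_vars_subst.2 ⟨x, hxt, hy⟩⟩

theorem Term.vars_finite {k : L.Srt} (t : Term L k) : t.vars.Finite := by
  cases t <;> simp [Term.vars]

theorem Atom.vars_finite (a : Atom L) : a.vars.Finite := by
  have : a.vars = ⋃ t ∈ {t | t ∈ a.full}, t.2.vars := by
    ext; simp [Atom.vars]
  rw [this]
  exact (List.finite_toSet _).biUnion fun t _ => t.2.vars_finite

theorem spVars_finite (φ : Spatial L) : (spVars φ).Finite := by
  have : spVars φ = ⋃ a ∈ {a | a ∈ φ}, a.vars := by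
    ext; simp [spVars]
  rw [this]
  refine Set.Finite.biUnion ?_ fun a _ => a.vars_finite
  exact (φ.toFinset.finite_toSet).subset fun a ha => by simpa using ha

/-! ### Unfoldings and the transfer of satisfaction -/

/-- A store `s₀` of the parameters and existential variables of a rule can be realized on any
unfolding of the rule, by modifying only the existential variables of this unfolding. -/
theorem IRule.exists_store {r : IRule L} {a : Atom L} {θ : Subst L}
    (hhead : r.headAtom.subst θ = a)
    (hex : ∀ x ∈ r.exVars, ∃ m : ℕ, θ x.1 x.2 = .var m ∧ (x.1, m) ∉ a.vars)
    (hinj : Set.InjOn (fun x : Var L => (⟨x.1, θ x.1 x.2⟩ : ATerm L)) r.exVars)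
    {s s₀ : Store M} (hg : s.ground a = s₀.ground r.headAtom) :
    ∃ s' : Store M,
      (∀ y : Var L, y ∉ (r.body.subst θ).vars \ a.vars → s' y.1 y.2 = s y.1 y.2) ∧
      ∀ x ∈ r.body.vars, (s'.comp θ) x.1 x.2 = s₀ x.1 x.2 := by
  -- by `hinj`, the value chosen for a renamed existential variable is unambiguous
  let s' : Store M := fun k m =>
    if h : ∃ n, (k, n) ∈ r.exVars ∧ θ k n = .var m then s₀ k h.choose else s k m
  have hs' : ∀ y : Var L, y ∉ (r.body.subst θ).vars \ a.vars → s' y.1 y.2 = s y.1 y.2 := by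
    rintro ⟨k, m⟩ hy
    refine dif_neg ?_
    rintro ⟨n, hn, hθ⟩
    obtain ⟨m', hm', hma⟩ := hex _ hn
    obtain rfl : m = m' := by simpa [hθ] using hm'
    exact hy ⟨SymHeap.mem_vars_subst hn.1 (by rw [hθ]; rfl), hma⟩
  refine ⟨s', hs', fun x hx => ?_⟩
  by_cases hxh : x ∈ r.headAtom.vars
  · have h1 : s'.ground a = s.ground a :=
      Store.ground_eq_iff.2 fun y hy => hs' y fun h => h.2 hy
    rw [hg, ← hhead, Store.ground_subst] at h1
    exact Store.ground_eq_iff.1 h1 x hxh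
  · have hxe : x ∈ r.exVars := ⟨hx, hxh⟩
    obtain ⟨m, hm, -⟩ := hex x hxe
    have h : ∃ n, (x.1, n) ∈ r.exVars ∧ θ x.1 n = .var m := ⟨x.2, hxe, hm⟩
    have hc : (x.1, h.choose) = x :=
      hinj h.choose_spec.1 hxe (by simp only [h.choose_spec.2, hm])
    have : (s'.comp θ) x.1 x.2 = s₀ x.1 h.choose := by
      simp only [Store.comp, hm, Store.eval]
      exact dif_pos h
    rw [this]
    exact congrArg (fun y : Var L => s₀ x.1 y.2) hc

/-- Every atom with the right predicate symbol can be unfolded by a rule: the parameters are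
pairwise distinct, and there are enough variables to rename the existential ones apart. -/
theorem IRule.exists_subst (r : IRule L) (x : ℕ)
    (args : ∀ i : Fin (L.profile r.head).length, Term L ((L.profile r.head).get i)) :
    ∃ θ : Subst L, r.headAtom.subst θ = Atom.pred r.head x args ∧
      (∀ y ∈ r.exVars, ∃ m : ℕ, θ y.1 y.2 = .var m ∧
        (y.1, m) ∉ (Atom.pred r.head x args).vars) ∧
      Set.InjOn (fun y : Var L => (⟨y.1, θ y.1 y.2⟩ : ATerm L)) r.exVars := by
  obtain ⟨N, hN⟩ : ∃ N : ℕ, ∀ y ∈ (Atom.pred r.head x args).vars, y.2 < N := by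
    obtain ⟨N, hN⟩ := ((Atom.pred r.head x args).vars_finite.image Prod.snd).bddAbove
    exact ⟨N + 1, fun y hy => Nat.lt_succ_of_le (hN ⟨y, hy, rfl⟩)⟩
  obtain ⟨hroot, hpar⟩ := List.nodup_cons.1 r.distinct
  rw [List.nodup_ofFn] at hpar
  -- the graph of the binding of the parameters
  let B : ∀ k : L.Srt, ℕ → Term L k → Prop := fun k n t =>
    ((k, n) = (L.loc, r.root) ∧ (⟨k, t⟩ : ATerm L) = ⟨L.loc, .var x⟩) ∨
    ∃ i, (k, n) = ((L.profile r.head).get i, r.params i) ∧ (⟨k, t⟩ : ATerm L) = ⟨_, args i⟩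
  let θ : Subst L := fun k n => if h : ∃ t, B k n t then h.choose else .var (n + N)
  have hθ : ∀ k n, (∃ t, B k n t) → B k n (θ k n) := by
    intro k n h
    simp only [θ, dif_pos h]
    exact h.choose_spec
  have hθroot : θ L.loc r.root = .var x := by
    rcases hθ L.loc r.root ⟨_, .inl ⟨rfl, rfl⟩⟩ with h | ⟨i, hi, -⟩
    · simpa using h.2
    · exact (hroot (by rw [hi]; exact (List.mem_ofFn' _ _).2 ⟨i, rfl⟩)).elim
  have hθpar : ∀ i, θ _ (r.params i) = args i := by
    intro i
    rcases hθ _ (r.params i) ⟨args i, .inr ⟨i, rfl, rfl⟩⟩ with h | ⟨j, hj, h⟩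
    · exact (hroot (by rw [← h.1]; exact (List.mem_ofFn' _ _).2 ⟨i, rfl⟩)).elim
    · obtain rfl := hpar hj
      simpa using h
  have hθex : ∀ y ∈ r.exVars, θ y.1 y.2 = .var (y.2 + N) := by
    intro y hy
    refine dif_neg ?_
    rintro ⟨t, h | ⟨i, hi, -⟩⟩
    · exact hy.2 (by rw [show y = _ from h.1]; exact Atom.root_mem_vars r.headAtom)
    · refine hy.2 (Atom.mem_vars.2 (.inr ⟨_, (List.mem_ofFn' _ _).2 ⟨i, rfl⟩, ?_⟩))
      rw [show y = _ from hi]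
      rfl
  refine ⟨θ, ?_, fun y hy => ⟨_, hθex y hy, fun h => ?_⟩, fun y hy y' hy' h => ?_⟩
  · simp only [IRule.headAtom, Atom.subst, hθroot, locName, Term.subst, hθpar]
  · have := hN _ h
    simp at this
  · simp only [hθex y hy, hθex y' hy'] at h
    obtain ⟨k, n⟩ := y
    obtain ⟨k', n'⟩ := y'
    obtain rfl : k = k' := congrArg Sigma.fst h
    simpa using h

/-- Satisfaction of a spatial formula only depends on the ground instances of its atoms. -/
theorem SatSp.transfer {s : Store M} {h : Heap M} {φ : Spatial L} (H : SatSp M R s h φ) :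
    ∀ {s₂ : Store M} {φ₂ : Spatial L}, φ₂.map s₂.ground = φ.map s.ground →
      SatSp M R s₂ h φ₂ := by
  induction H with
  | emp s h he =>
    intro s₂ φ₂ hg
    obtain rfl : φ₂ = 0 := by simpa using hg
    exact .emp _ _ he
  | pto s h x ts hs =>
    intro s₂ φ₂ hg
    rw [Multiset.map_singleton, Multiset.map_eq_singleton] at hg
    obtain ⟨a, rfl, ha⟩ := hg
    cases a with
    | pto y us =>
      simp only [Store.ground, GroundAtom.pto.injEq] at ha
      exact .pto _ _ _ _ (by rw [ha.1, ha.2]; exact hs)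
    | pred => simp [Store.ground] at ha
  | sep s h h₁ h₂ φ₁ φ₂ hu _ _ ih₁ ih₂ =>
    intro s₂ ψ hg
    rw [Multiset.map_add, ← Multiset.rel_eq, Multiset.rel_map_left,
      Multiset.rel_add_right] at hg
    obtain ⟨ψ₁, ψ₂, hψ₁, hψ₂, rfl⟩ := hg
    rw [← Multiset.rel_map_left, Multiset.rel_eq] at hψ₁ hψ₂
    exact .sep _ _ _ _ _ _ hu (ih₁ hψ₁) (ih₂ hψ₂)
  | pred s s' h p x args r hr lam hu hs' hp hsp ih =>
    intro s₂ φ₂ hg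
    rw [Multiset.map_singleton, Multiset.map_eq_singleton] at hg
    obtain ⟨a, rfl, ha⟩ := hg
    obtain ⟨θ, hhead, -, -, rfl⟩ := hu
    -- the rule is unfolded again, on the other atom, with the same values of its variables
    have h0 : s.ground (Atom.pred p x args) = (s'.comp θ).ground r.headAtom := by
      rw [← Store.ground_subst, hhead]
      exact Store.ground_eq_iff.2 fun y hy => (hs' y fun h => h.2 hy).symm
    rw [h0] at ha
    cases a with
    | pto => simp [Store.ground, IRule.headAtom] at ha
    | pred q x₂ args₂ =>
      obtain rfl : q = r.head := by
        simp only [Store.ground, IRule.headAtom, GroundAtom.pred.injEq] at ha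
        exact ha.1
      obtain ⟨θ₂, hhead₂, hex₂, hinj₂⟩ := r.exists_subst x₂ args₂
      obtain ⟨s₂', hs₂', hbody⟩ := IRule.exists_store hhead₂ hex₂ hinj₂ ha
      refine .pred _ s₂' _ _ _ _ r hr (r.body.subst θ₂) ⟨θ₂, hhead₂, hex₂, hinj₂, rfl⟩ hs₂' ?_
        (ih ?_)
      · refine (Store.satPure_subst _ _ _).2 ((Store.satPure_congr fun y hy => ?_).2
          ((Store.satPure_subst _ _ _).1 hp))
        exact hbody y (.inr hy)
      · simp only [SymHeap.subst, Store.map_ground_subst]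
        exact Store.map_ground_congr fun y hy => hbody y (.inl hy)

theorem Sat.congr {s s' : Store M} {h : Heap M} {lam : SymHeap L}
    (hs : ∀ x ∈ lam.vars, s' x.1 x.2 = s x.1 x.2) (H : Sat M R s h lam) : Sat M R s' h lam :=
  ⟨H.1.transfer (Store.map_ground_congr fun x hx => hs x (.inl hx)),
    (Store.satPure_congr fun x hx => hs x (.inr hx)).2 H.2⟩

theorem sat_subst {s : Store M} {σ : Subst L} {h : Heap M} {lam : SymHeap L} :
    Sat M R s h (lam.subst σ) ↔ Sat M R (s.comp σ) h lam :=
  and_congr ⟨fun H => H.transfer (s.map_ground_subst σ _).symm,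
    fun H => H.transfer (s.map_ground_subst σ _)⟩ (s.satPure_subst σ _)

/-! ### Heaps -/

theorem Heap.IsDisjointUnion.symm {h h₁ h₂ : Heap M} (H : h.IsDisjointUnion h₁ h₂) :
    h.IsDisjointUnion h₂ h₁ := fun l => (H l).symm

theorem Heap.IsDisjointUnion.dom_eq {h h₁ h₂ : Heap M} (H : h.IsDisjointUnion h₁ h₂) :
    h.dom = h₁.dom ∪ h₂.dom := by
  ext l
  rcases H l with ⟨h0, h1⟩ | ⟨h0, h1⟩ <;> simp [Heap.dom, h0, h1]

theorem Heap.IsDisjointUnion.disjoint {h h₁ h₂ : Heap M} (H : h.IsDisjointUnion h₁ h₂) :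
    Disjoint h₁.dom h₂.dom := by
  rw [Set.disjoint_left]
  intro l h1 h2
  rcases H l with ⟨h0, -⟩ | ⟨h0, -⟩
  · exact h1 h0
  · exact h2 h0

theorem Heap.IsDisjointUnion.ncard_lt {h h₁ h₂ : Heap M} (H : h.IsDisjointUnion h₁ h₂)
    (hne : h₂.dom.Nonempty) : h₁.dom.ncard < h.dom.ncard := by
  rw [H.dom_eq, Set.ncard_union_eq H.disjoint h₁.finite h₂.finite]
  exact Nat.lt_add_of_pos_right ((Set.ncard_pos h₂.finite).2 hne)

theorem Heap.IsDisjointUnion.eq_right {h h₁ h₂ : Heap M} (H : h.IsDisjointUnion h₁ h₂)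
    (he : ∀ l, h₁.map l = none) : h = h₂ := by
  ext1
  funext l
  rcases H l with ⟨-, h1⟩ | ⟨h0, h1⟩
  · exact h1
  · rw [h1, he, h0]

/-- The union of two heaps, the first one taking precedence. -/
def Heap.union (h₁ h₂ : Heap M) : Heap M where
  map l := (h₁.map l).or (h₂.map l)
  finite := (h₁.finite.union h₂.finite).subset fun l hl => by
    by_contra hc
    simp only [Set.mem_union, Set.mem_ofPred_eq, not_or, not_not] at hc
    exact hl (by simp [hc.1, hc.2])

theorem Heap.IsDisjointUnion.assoc {h h₁ h₂ k₁ k₂ : Heap M} (H : h.IsDisjointUnion h₁ h₂)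
    (H₁ : h₁.IsDisjointUnion k₁ k₂) :
    h.IsDisjointUnion k₁ (k₂.union h₂) ∧ (k₂.union h₂).IsDisjointUnion k₂ h₂ := by
  constructor <;> intro l <;>
  · have a := H l
    have b := H₁ l
    simp only [Heap.union]
    rcases a with ⟨a, a'⟩ | ⟨a, a'⟩ <;> rcases b with ⟨b, b'⟩ | ⟨b, b'⟩ <;> simp_all

theorem Heap.isDisjointUnion_of_empty {h e : Heap M} (he : ∀ l, e.map l = none) :
    h.IsDisjointUnion h e := fun l => .inr ⟨he l, rfl⟩

/-- The empty heap. -/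
def Heap.empty (M : Universe.{u, v, w, z} L) : Heap M where
  map _ := none
  finite := by simp

/-! ### Inversion of satisfaction -/

theorem SatSp.map_eq_none {s : Store M} {h : Heap M} (H : SatSp M R s h 0) (l : M.Dom L.loc) :
    h.map l = none := by
  generalize hφ : (0 : Spatial L) = φ at H
  induction H with
  | emp s h he => exact he l
  | pto | pred => exact absurd hφ (by simp)
  | sep s h h₁ h₂ φ₁ φ₂ hu _ _ ih₁ ih₂ =>
    obtain ⟨rfl, rfl⟩ := add_eq_zero.1 hφ.symm
    rcases hu l with ⟨-, h⟩ | ⟨-, h⟩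
    · exact h.trans (ih₂ rfl)
    · exact h.trans (ih₁ rfl)

theorem SatSp.exists_cons {s : Store M} {h : Heap M} {a : Atom L} {φ : Spatial L}
    (H : SatSp M R s h (a ::ₘ φ)) :
    ∃ h₁ h₂ : Heap M, h.IsDisjointUnion h₁ h₂ ∧ SatSp M R s h₁ {a} ∧ SatSp M R s h₂ φ := by
  generalize hψ : a ::ₘ φ = ψ at H
  induction H generalizing φ with
  | emp s h he => exact absurd hψ (by simp)
  | pto s h x ts hs =>
    obtain ⟨rfl, rfl⟩ := (Multiset.singleton_eq_cons_iff _).1 hψ.symm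
    exact ⟨h, .empty M, Heap.isDisjointUnion_of_empty fun _ => rfl, .pto _ _ _ _ hs,
      .emp _ _ fun _ => rfl⟩
  | pred s s' h p x args r hr lam hu hs' hp hsp =>
    obtain ⟨rfl, rfl⟩ := (Multiset.singleton_eq_cons_iff _).1 hψ.symm
    exact ⟨h, .empty M, Heap.isDisjointUnion_of_empty fun _ => rfl,
      .pred _ s' _ _ _ _ r hr lam hu hs' hp hsp, .emp _ _ fun _ => rfl⟩
  | sep s h h₁ h₂ φ₁ φ₂ hu H₁ H₂ ih₁ ih₂ =>
    rcases Multiset.mem_add.1 (hψ ▸ Multiset.mem_cons_self a φ) with ha | ha <;>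
      obtain ⟨c, rfl⟩ := Multiset.exists_cons_of_mem ha
    · obtain rfl : φ = c + φ₂ := by simpa using hψ
      obtain ⟨k₁, k₂, hk, K₁, K₂⟩ := ih₁ rfl
      have := hu.assoc hk
      exact ⟨k₁, _, this.1, K₁, .sep _ _ _ _ _ _ this.2 K₂ H₂⟩
    · obtain rfl : φ = c + φ₁ := by simpa [add_comm] using hψ
      obtain ⟨k₁, k₂, hk, K₁, K₂⟩ := ih₂ rfl
      have := hu.symm.assoc hk
      exact ⟨k₁, _, this.1, K₁, .sep _ _ _ _ _ _ this.2 K₂ H₁⟩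

theorem SatSp.exists_add {s : Store M} {φ₁ φ₂ : Spatial L} :
    ∀ {h : Heap M}, SatSp M R s h (φ₁ + φ₂) →
      ∃ h₁ h₂ : Heap M, h.IsDisjointUnion h₁ h₂ ∧ SatSp M R s h₁ φ₁ ∧ SatSp M R s h₂ φ₂ := by
  induction φ₁ using Multiset.induction_on with
  | empty =>
    intro h H
    rw [zero_add] at H
    exact ⟨.empty M, h, (Heap.isDisjointUnion_of_empty fun _ => rfl).symm,
      .emp _ _ fun _ => rfl, H⟩
  | cons a φ ih =>
    intro h H
    rw [Multiset.cons_add] at H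
    obtain ⟨h₁, k, hk, H₁, K⟩ := H.exists_cons
    obtain ⟨k₁, k₂, hk', K₁, K₂⟩ := ih K
    have := hk.symm.assoc hk'.symm
    refine ⟨_, k₂, this.1.symm, ?_, K₂⟩
    rw [← Multiset.singleton_add]
    exact .sep _ _ _ _ _ _ this.2.symm H₁ K₁

theorem SatSp.exists_unfolding {s : Store M} {h : Heap M} {p : L.Pred} {x : ℕ}
    {args : ∀ i : Fin (L.profile p).length, Term L ((L.profile p).get i)}
    (H : SatSp M R s h {Atom.pred p x args}) :
    ∃ s₀ : Store M, ∃ r ∈ R, s.ground (Atom.pred p x args) = s₀.ground r.headAtom ∧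
      Sat M R s₀ h r.body := by
  generalize hψ : ({Atom.pred p x args} : Spatial L) = ψ at H
  induction H with
  | emp s h he => exact absurd hψ (by simp)
  | pto s h y ts hs => exact absurd hψ (by simp)
  | pred s s' h q y args' r hr lam hu hs' hp hsp =>
    obtain ⟨θ, hhead, -, -, rfl⟩ := hu
    refine ⟨s'.comp θ, r, hr, ?_, sat_subst.1 ⟨hsp, hp⟩⟩
    rw [Multiset.singleton_inj.1 hψ, ← Store.ground_subst, hhead]
    exact Store.ground_eq_iff.2 fun y hy => (hs' y fun h => h.2 hy).symm
  | sep s h h₁ h₂ φ₁ φ₂ hu H₁ H₂ ih₁ ih₂ =>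
    rcases Multiset.mem_add.1 (hψ ▸ Multiset.mem_singleton_self (Atom.pred p x args)) with
      ha | ha <;> obtain ⟨c, rfl⟩ := Multiset.exists_cons_of_mem ha
    · rw [Multiset.cons_add, Multiset.singleton_eq_cons_iff, add_eq_zero] at hψ
      obtain ⟨-, rfl, rfl⟩ := hψ
      rw [hu.symm.eq_right H₂.map_eq_none]
      exact ih₁ rfl
    · rw [Multiset.add_cons, Multiset.singleton_eq_cons_iff, add_eq_zero] at hψ
      obtain ⟨-, rfl, rfl⟩ := hψ
      rw [hu.eq_right H₁.map_eq_none]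
      exact ih₂ rfl

/-- The roots of the atoms denote pairwise distinct allocated locations: the body of a `P`-rule
allocates the first parameter. -/
theorem SatSp.roots (hP : ∀ r ∈ R, r.IsPRule) {s : Store M} {h : Heap M} {φ : Spatial L}
    (H : SatSp M R s h φ) :
    (∀ x ∈ alloc φ, s L.loc x ∈ h.dom) ∧ ((alloc φ).map (s L.loc)).Nodup := by
  induction H with
  | emp => simp [alloc]
  | pto s h x ts hs => simp [alloc, Atom.root, Heap.dom, hs.1]
  | sep s h h₁ h₂ φ₁ φ₂ hu _ _ ih₁ ih₂ =>
    simp only [alloc, Multiset.map_add] at ih₁ ih₂ ⊢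
    refine ⟨fun x hx => ?_, Multiset.nodup_add.2 ⟨ih₁.2, ih₂.2, ?_⟩⟩
    · rw [hu.dom_eq]
      exact (Multiset.mem_add.1 hx).imp (ih₁.1 x) (ih₂.1 x)
    · rw [Multiset.disjoint_left]
      intro l h1 h2
      obtain ⟨x, hx, rfl⟩ := Multiset.mem_map.1 h1
      obtain ⟨y, hy, hxy⟩ := Multiset.mem_map.1 h2
      exact Set.disjoint_left.1 hu.disjoint (ih₁.1 x hx) (hxy ▸ ih₂.1 y hy)
  | pred s s' h p x args r hr lam hu hs' hp hsp ih =>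
    obtain ⟨θ, hhead, -, -, rfl⟩ := hu
    obtain ⟨ys, Q, hsp, -⟩ := hP r hr
    have hroot : locName (θ L.loc r.root) = x := by
      have := congrArg Atom.root hhead
      rwa [Atom.root_subst] at this
    have hs : s' L.loc x = s L.loc x :=
      hs' (L.loc, x) fun h => h.2 (Atom.root_mem_vars (Atom.pred p x args))
    have := ih.1 x (by simp [SymHeap.subst, Spatial.subst, hsp, alloc, Atom.subst, Atom.root,
      hroot])
    simpa [alloc, Atom.root, ← hs] using this

theorem SatSp.card_le (hP : ∀ r ∈ R, r.IsPRule) {s : Store M} {h : Heap M} {φ : Spatial L}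
    (H : SatSp M R s h φ) : Multiset.card φ ≤ h.dom.ncard := by
  obtain ⟨h1, h2⟩ := H.roots hP
  have hc : Multiset.card φ = ((alloc φ).map (s L.loc)).toFinset.card := by
    rw [Multiset.toFinset_card_of_nodup h2, Multiset.card_map, alloc, Multiset.card_map]
  rw [hc, ← Set.ncard_coe_finset]
  refine Set.ncard_le_ncard (fun l hl => ?_) h.finite
  obtain ⟨x, hx, rfl⟩ := Multiset.mem_map.1 (Multiset.mem_toFinset.1 hl)
  exact h1 x hx

/-! ### Local soundness of the inference rules -/

theorem nodup_map_iff {α β : Type*} (f : α → β) (V : Multiset α) :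
    (V.map f).Nodup ↔ ∀ x y, ({x, y} : Multiset α) ≤ V → f x ≠ f y := by
  constructor
  · intro h x y hxy
    have := Multiset.nodup_of_le (Multiset.map_le_map hxy) h
    simpa using this
  · induction V using Multiset.induction_on with
    | empty => simp
    | cons c V ih =>
      intro h
      rw [Multiset.map_cons, Multiset.nodup_cons]
      refine ⟨fun hc => ?_, ih fun x y hxy => h x y (hxy.trans (Multiset.le_cons_self _ _))⟩
      obtain ⟨y, hy, hyc⟩ := Multiset.mem_map.1 hc
      exact h c y (Multiset.cons_le_cons c (Multiset.singleton_le.2 hy)) hyc.symm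

theorem Sequent.isCounterModel_iff {Q : Sequent L} {s : Store M} {h : Heap M} :
    Q.IsCounterModel M R s h ↔ Sat M R s h Q.lhs ∧ ¬ Sat M R s h Q.rhs ∧
      (∀ x ∈ Q.nal, s L.loc x ∉ h.dom) ∧ (Q.nal.map (s L.loc)).Nodup := by
  rw [Sequent.IsCounterModel, nodup_map_iff]

/-- In a counter-model, the allocated and the explicitly non-allocated variables denote pairwise
distinct locations. -/
theorem nodup_map_alloc_add (hP : ∀ r ∈ R, r.IsPRule) {s : Store M} {h k : Heap M}
    {φ : Spatial L} {V : Multiset ℕ} (H : SatSp M R s k φ) (hk : k.dom ⊆ h.dom)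
    (hV : ∀ x ∈ V, s L.loc x ∉ h.dom) (hV' : (V.map (s L.loc)).Nodup) :
    ((V + alloc φ).map (s L.loc)).Nodup := by
  rw [Multiset.map_add, Multiset.nodup_add]
  refine ⟨hV', (H.roots hP).2, Multiset.disjoint_left.2 fun h1 h2 => ?_⟩
  obtain ⟨x, hx, rfl⟩ := Multiset.mem_map.1 h1
  obtain ⟨y, hy, hxy⟩ := Multiset.mem_map.1 h2
  exact hV x hx (hxy ▸ hk ((H.roots hP).1 y hy))

theorem Sequent.IsAxiom.not_isCounterModel (hP : ∀ r ∈ R, r.IsPRule) {Q : Sequent L}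
    (hQ : Q.IsAxiom) (s : Store M) (h : Heap M) : ¬ Q.IsCounterModel M R s h := by
  rw [Sequent.isCounterModel_iff]
  rintro ⟨hl, hr, hV, hV'⟩
  rcases hQ with ⟨h1, h2⟩ | ⟨k, t, ht⟩ | hd | ⟨x, hx, hxV⟩ | hd
  · exact hr ⟨h1 ▸ hl.1, fun l hl' => hl.2 l (h2 hl')⟩
  · exact hl.2 _ ht (by simp)
  · exact hd (Multiset.Nodup.of_map _ (hl.1.roots hP).2)
  · exact hV x hxV ((hl.1.roots hP).1 x hx)
  · exact hd (Multiset.Nodup.of_map _ hV')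

theorem Entails.satPure {lam : SymHeap L} {V : Multiset ℕ} {ξ : Pure L} (H : Entails lam V ξ)
    {s : Store M} (hl : s.SatPure lam.pure)
    (hd : ((V + alloc lam.sp).map (s L.loc)).Nodup) : s.SatPure ξ := by
  intro l hlξ
  rcases H l hlξ with h | ⟨k, n, rfl⟩ | ⟨k, c, d, hcd, rfl⟩ | ⟨x, y, rfl, hxy⟩
  · exact hl l h
  · simp [Store.SatLit]
  · simpa [Store.SatLit, Store.eval] using fun h => hcd (M.cval_injective k h)
  · rw [add_comm] at hxy
    simpa [Store.SatLit, Store.eval] using (nodup_map_iff _ _).1 hd x y hxy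

theorem Subst.single_self (k : L.Srt) (x : ℕ) (t : Term L k) : Subst.single k x t k x = t := by
  simp [Subst.single]

theorem Subst.single_of_ne {k k' : L.Srt} {x n : ℕ} {t : Term L k}
    (h : ((k', n) : Var L) ≠ (k, x)) : Subst.single k x t k' n = .var n := by
  by_cases hk : k' = k
  · subst hk
    have : n ≠ x := fun hn => h (by rw [hn])
    simp [Subst.single, this]
  · simp [Subst.single, hk]

theorem Store.comp_single {s : Store M} {k : L.Srt} {x : ℕ} {t : Term L k}
    (h : s k x = s.eval t) : s.comp (Subst.single k x t) = s := by
  funext k' n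
  by_cases hn : ((k', n) : Var L) = (k, x)
  · cases hn
    rw [Store.comp, Subst.single_self, h]
  · rw [Store.comp, Subst.single_of_ne hn]
    rfl

theorem Sequent.IsCounterModel.subst {Q : Sequent L} {s : Store M} {h : Heap M} {σ : Subst L}
    (H : Q.IsCounterModel M R s h) (hσ : s.comp σ = s) :
    (Q.subst σ).IsCounterModel M R s h := by
  rw [Sequent.isCounterModel_iff] at H ⊢
  have hn : ∀ n, s L.loc (locName (σ L.loc n)) = s L.loc n := fun n => by
    refine (s.apply_locName _).trans ?_
    exact congrFun (congrFun hσ L.loc) n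
  simp only [Sequent.subst, sat_subst, hσ, Multiset.map_map, Function.comp_def, hn,
    Multiset.mem_map, forall_exists_index, and_imp, forall_apply_eq_imp_iff₂]
  exact H

/-- A counter-model of the conclusion of the separation rule splits into two heaps, one of which
is a counter-model of the corresponding premise. -/
theorem isCounterModel_separation (hP : ∀ r ∈ R, r.IsPRule) {φ₁ φ₂ ψ₁ ψ₂ : Spatial L}
    {ξ₁ ξ₂ ζ₁ ζ₂ : Pure L} {V : Multiset ℕ} {s : Store M} {h : Heap M}
    (H : Sequent.IsCounterModel M R ⟨⟨φ₁ + φ₂, ξ₁ ∪ ξ₂⟩, ⟨ψ₁ + ψ₂, ζ₁ ∪ ζ₂⟩, V⟩ s h) :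
    ∃ h₁ h₂ : Heap M, h.IsDisjointUnion h₁ h₂ ∧ SatSp M R s h₁ φ₁ ∧ SatSp M R s h₂ φ₂ ∧
      (Sequent.IsCounterModel M R ⟨⟨φ₁, ξ₁⟩, ⟨ψ₁, ζ₁⟩, V + alloc φ₂⟩ s h₁ ∨
        Sequent.IsCounterModel M R ⟨⟨φ₂, ξ₂⟩, ⟨ψ₂, ζ₂⟩, V + alloc φ₁⟩ s h₂) := by
  simp only [Sequent.isCounterModel_iff] at H ⊢
  obtain ⟨⟨hsp, hξ⟩, hr, hV, hV'⟩ := H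
  obtain ⟨h₁, h₂, hu, H₁, H₂⟩ := hsp.exists_add
  refine ⟨h₁, h₂, hu, H₁, H₂, ?_⟩
  have hd₁ : h₁.dom ⊆ h.dom := hu.dom_eq ▸ Set.subset_union_left
  have hd₂ : h₂.dom ⊆ h.dom := hu.dom_eq ▸ Set.subset_union_right
  have hdis := Set.disjoint_left.1 hu.disjoint
  by_cases hr₁ : Sat M R s h₁ ⟨ψ₁, ζ₁⟩
  · refine .inr ⟨⟨H₂, fun l hl => hξ l (Finset.mem_union_right _ hl)⟩, fun hr₂ => hr ?_, ?_,
      nodup_map_alloc_add hP H₁ hd₁ hV hV'⟩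
    · exact ⟨.sep _ _ _ _ _ _ hu hr₁.1 hr₂.1, fun l hl =>
        (Finset.mem_union.1 hl).elim (hr₁.2 l) (hr₂.2 l)⟩
    · intro x hx hx'
      rcases Multiset.mem_add.1 hx with hx | hx
      · exact hV x hx (hd₂ hx')
      · exact hdis ((H₁.roots hP).1 x hx) hx'
  · refine .inl ⟨⟨H₁, fun l hl => hξ l (Finset.mem_union_left _ hl)⟩, hr₁, ?_,
      nodup_map_alloc_add hP H₂ hd₂ hV hV'⟩
    intro x hx hx'
    rcases Multiset.mem_add.1 hx with hx | hx
    · exact hV x hx (hd₁ hx')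
    · exact hdis hx' ((H₂.roots hP).1 x hx)

/-- A counter-model of a sequent whose left-hand side contains a predicate atom gives a
counter-model of the sequent obtained by unfolding this atom with the rule used in the model: the
existential variables are fresh, hence their values can be chosen freely. -/
theorem exists_isCounterModel_unfolding {p : L.Pred} {x : ℕ}
    {args : ∀ i : Fin (L.profile p).length, Term L ((L.profile p).get i)}
    {φ : Spatial L} {ξ : Pure L} {γ : SymHeap L} {V : Multiset ℕ} {s : Store M} {h : Heap M}
    (H : Sequent.IsCounterModel M R ⟨⟨Atom.pred p x args ::ₘ φ, ξ⟩, γ, V⟩ s h) :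
    ∃ r ∈ R, r.head = p ∧ ∀ lam : SymHeap L, r.Unfolds (Atom.pred p x args) lam →
      (∀ y ∈ lam.vars, y ∉ (Atom.pred p x args).vars →
        y ∉ Sequent.vars ⟨⟨Atom.pred p x args ::ₘ φ, ξ⟩, γ, V⟩) →
      ∃ s' : Store M,
        Sequent.IsCounterModel M R ⟨⟨lam.sp + φ, lam.pure ∪ ξ⟩, γ, V⟩ s' h := by
  simp only [Sequent.isCounterModel_iff] at H ⊢
  obtain ⟨⟨hsp, hξ⟩, hr, hV, hV'⟩ := H
  obtain ⟨h₁, h₂, hu, H₁, H₂⟩ := hsp.exists_cons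
  obtain ⟨s₀, r, hrR, hg, hbody⟩ := H₁.exists_unfolding
  refine ⟨r, hrR, ?_, ?_⟩
  · simp only [Store.ground, IRule.headAtom, GroundAtom.pred.injEq] at hg
    exact hg.1.symm
  · rintro _ ⟨θ, hhead, hex, hinj, rfl⟩ hfresh
    obtain ⟨s', hs', hs₀⟩ := IRule.exists_store hhead hex hinj hg
    have hag : ∀ y ∈ Sequent.vars ⟨⟨Atom.pred p x args ::ₘ φ, ξ⟩, γ, V⟩,
        s' y.1 y.2 = s y.1 y.2 := fun y hy => hs' y fun hc => hfresh y hc.1 hc.2 hy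
    have hagV : ∀ n ∈ V, s' L.loc n = s L.loc n := fun n hn =>
      hag (L.loc, n) (.inr ⟨rfl, hn⟩)
    have hunf : Sat M R s' h₁ (r.body.subst θ) := sat_subst.2 (hbody.congr hs₀)
    have hrest : Sat M R s' h₂ ⟨φ, ξ⟩ := by
      refine Sat.congr (s := s) (fun y hy => hag y (.inl (.inl ?_))) ⟨H₂, hξ⟩
      refine hy.imp ?_ id
      rintro ⟨a, ha, hya⟩
      exact ⟨a, Multiset.mem_cons_of_mem ha, hya⟩
    refine ⟨s', ⟨.sep _ _ _ _ _ _ hu hunf.1 hrest.1, fun l hl =>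
      (Finset.mem_union.1 hl).elim (hunf.2 l) (hrest.2 l)⟩, fun hγ => hr ?_, ?_, ?_⟩
    · exact hγ.congr fun y hy => (hag y (.inl (.inr hy))).symm
    · intro n hn
      rw [hagV n hn]
      exact hV n hn
    · rwa [Multiset.map_congr rfl hagV]

/-- A predicate atom is satisfied as soon as some instance of an unfolding is: the store
`s.comp σ` only differs from `s` on existential variables. -/
theorem SatSp.fold {p : L.Pred} {x : ℕ}
    {args : ∀ i : Fin (L.profile p).length, Term L ((L.profile p).get i)}
    {r : IRule L} (hr : r ∈ R) {us : List (ATerm L)} {ψ : Spatial L} {ζ : Pure L}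
    (hu : r.Unfolds (Atom.pred p x args) ⟨Atom.pto x us ::ₘ ψ, ζ⟩) {σ : Subst L}
    (hdom : ∀ y : Var L, σ y.1 y.2 ≠ .var y.2 →
      (⟨y.1, .var y.2⟩ : ATerm L) ∈ us ∧ y ∉ (Atom.pred p x args).vars)
    {s : Store M} {h : Heap M} (hζ : s.SatPure (Pure.subst σ ζ))
    (H : SatSp M R s h (Atom.pto x (us.map (ATerm.subst σ)) ::ₘ Spatial.subst σ ψ)) :
    SatSp M R s h {Atom.pred p x args} := by
  refine .pred s (s.comp σ) h p x args r hr _ hu (fun y hy => ?_)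
    ((s.satPure_subst σ ζ).1 hζ) (H.transfer ?_)
  · by_contra hne
    have hσ : σ y.1 y.2 ≠ .var y.2 := fun h => hne (by rw [Store.comp, h]; rfl)
    obtain ⟨hyu, hya⟩ := hdom y hσ
    exact hy ⟨.inl ⟨_, Multiset.mem_cons_self _ _,
      Atom.mem_vars.2 (.inr ⟨_, hyu, rfl⟩)⟩, hya⟩
  · have hx : σ L.loc x = .var x := by
      by_contra hne
      exact (hdom (L.loc, x) hne).2 (Atom.root_mem_vars (Atom.pred p x args))
    rw [show Atom.pto x (us.map (ATerm.subst σ)) = (Atom.pto x us).subst σ by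
      simp [Atom.subst, hx, locName], Multiset.map_cons, Multiset.map_cons,
      Store.ground_subst, Store.map_ground_subst]

/-! ### The termination order -/

/-- The number of points-to atoms. -/
def ptoCount (φ : Spatial L) : ℕ := φ.countP fun a => ¬ a.IsPred

/-- The number of equations. -/
def eqCount (ξ : Pure L) : ℕ := (ξ.filter Lit.IsEq).card

/-- A bound on the number of applications of the replacement, elimination, unfolding and imitation
rules between two applications of the separation rule, for counter-models with heap `h`. The third
summand counts the locations of `h` that are not yet described by a points-to atom, and the last
one is `1` as long as the imitation rule has not been applied. -/
def Sequent.workload (Q : Sequent L) (h : Heap M) : ℕ :=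
  eqCount Q.lhs.pure + Q.rhs.pure.card + (h.dom.ncard - ptoCount Q.lhs.sp) +
    if ∀ a ∈ Q.rhs.sp, a.IsPred then 1 else 0

/-- The variables of sort `loc` of the spatial parts. -/
def Sequent.spLocVars (Q : Sequent L) : Set ℕ :=
  {n | (L.loc, n) ∈ spVars Q.lhs.sp ∪ spVars Q.rhs.sp}

/-- The pairs of variables on which case splitting may still be applied. -/
def Sequent.undecided (Q : Sequent L) : Set (ℕ × ℕ) :=
  {c | c.1 ∈ alloc Q.lhs.sp ∧ (L.loc, c.2) ∈ spVars Q.rhs.sp ∧ c.2 ∉ alloc Q.lhs.sp ∧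
    c.2 ∉ Q.nal ∧ Lit.ne L.loc s(.var c.1, .var c.2) ∉ Q.lhs.pure}

/-- The measure of a sequent and of the heap of a counter-model, to be compared
lexicographically. -/
def Sequent.rank (Q : Sequent L) (h : Heap M) : ℕ × ℕ × ℕ × ℕ × ℕ :=
  (h.dom.ncard, Q.workload h, Q.spLocVars.ncard, Q.undecided.ncard,
    Q.lhs.pure.card + Multiset.card Q.nal)

/-- The lexicographic order on ranks. -/
def RankLT : ℕ × ℕ × ℕ × ℕ × ℕ → ℕ × ℕ × ℕ × ℕ × ℕ → Prop :=
  Prod.Lex (· < ·) (Prod.Lex (· < ·) (Prod.Lex (· < ·) (Prod.Lex (· < ·) (· < ·))))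

theorem rankLT_wf : WellFounded RankLT :=
  WellFounded.prod_lex Nat.lt_wfRel.wf (WellFounded.prod_lex Nat.lt_wfRel.wf
    (WellFounded.prod_lex Nat.lt_wfRel.wf (WellFounded.prod_lex Nat.lt_wfRel.wf
      Nat.lt_wfRel.wf)))

theorem rankLT_iff {a b c d e a' b' c' d' e' : ℕ} :
    RankLT (a, b, c, d, e) (a', b', c', d', e') ↔ a < a' ∨ a = a' ∧ (b < b' ∨ b = b' ∧
      (c < c' ∨ c = c' ∧ (d < d' ∨ d = d' ∧ e < e'))) := by
  simp [RankLT, Prod.lex_def]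

/-- Once the heap is fixed, the rank decreases as soon as one of its components does and the more
significant ones do not increase. -/
theorem Sequent.rank_lt_rank {Q Q' : Sequent L} {h : Heap M}
    (hw : Q'.workload h ≤ Q.workload h)
    (hv : Q'.spLocVars.ncard < Q.spLocVars.ncard ∨ Q'.spLocVars.ncard = Q.spLocVars.ncard ∧
      (Q'.undecided.ncard < Q.undecided.ncard ∨ Q'.undecided.ncard ≤ Q.undecided.ncard ∧
        Q'.lhs.pure.card + Multiset.card Q'.nal < Q.lhs.pure.card + Multiset.card Q.nal)) :
    RankLT (Q'.rank h) (Q.rank h) := by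
  rw [Sequent.rank, Sequent.rank, rankLT_iff]
  omega

theorem Sequent.spLocVars_finite (Q : Sequent L) : Q.spLocVars.Finite :=
  (((spVars_finite Q.lhs.sp).union (spVars_finite Q.rhs.sp)).image Prod.snd).subset
    fun n hn => ⟨(L.loc, n), hn, rfl⟩

theorem root_mem_spVars {φ : Spatial L} {x : ℕ} (h : x ∈ alloc φ) :
    (L.loc, x) ∈ spVars φ := by
  obtain ⟨a, ha, rfl⟩ := Multiset.mem_map.1 h
  exact ⟨a, ha, a.root_mem_vars⟩

theorem Sequent.undecided_finite (Q : Sequent L) : Q.undecided.Finite :=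
  (Q.spLocVars_finite.prod Q.spLocVars_finite).subset fun _ hc =>
    ⟨.inl (root_mem_spVars hc.1), .inr hc.2.1⟩

theorem ptoCount_subst (σ : Subst L) (φ : Spatial L) :
    ptoCount (Spatial.subst σ φ) = ptoCount φ := by
  rw [ptoCount, Spatial.subst, Multiset.countP_map, ptoCount, Multiset.countP_eq_card_filter]
  simp only [Atom.isPred_subst]

theorem ptoCount_le_card (φ : Spatial L) : ptoCount φ ≤ Multiset.card φ :=
  Multiset.countP_le_card _ _

theorem forall_isPred_subst {σ : Subst L} {φ : Spatial L} :
    (∀ a ∈ Spatial.subst σ φ, a.IsPred) ↔ ∀ a ∈ φ, a.IsPred := by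
  simp [Spatial.subst, Atom.isPred_subst]

theorem eqCount_subst_le (σ : Subst L) (ξ : Pure L) : eqCount (Pure.subst σ ξ) ≤ eqCount ξ := by
  refine le_trans (Finset.card_le_card ?_) (Finset.card_image_le (f := Lit.subst σ))
  intro l hl
  obtain ⟨hl, he⟩ := Finset.mem_filter.1 hl
  obtain ⟨l', hl', rfl⟩ := Finset.mem_image.1 hl
  refine Finset.mem_image_of_mem _ (Finset.mem_filter.2 ⟨hl', ?_⟩)
  cases l'
  · trivial
  · exact he

theorem eqCount_mono {ξ ξ' : Pure L} (h : ξ ⊆ ξ') : eqCount ξ ≤ eqCount ξ' :=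
  Finset.card_le_card (Finset.filter_subset_filter _ h)

theorem Sequent.workload_subst_le (Q : Sequent L) (σ : Subst L) (h : Heap M) :
    (Q.subst σ).workload h ≤ Q.workload h := by
  simp only [Sequent.workload, Sequent.subst, SymHeap.subst, ptoCount_subst,
    forall_isPred_subst]
  have := eqCount_subst_le σ Q.lhs.pure
  have : (Pure.subst σ Q.rhs.pure).card ≤ Q.rhs.pure.card := Finset.card_image_le
  omega

/-- The unfolding of a predicate atom by a `P`-rule has exactly one points-to atom and no
equation. -/
theorem IRule.Unfolds.counts {r : IRule L} (hr : r.IsPRule) {a : Atom L} {lam : SymHeap L}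
    (hu : r.Unfolds a lam) : ptoCount lam.sp = 1 ∧ ∀ l ∈ lam.pure, ¬ l.IsEq := by
  obtain ⟨θ, -, -, -, rfl⟩ := hu
  obtain ⟨ys, Q, hsp, hQ, hξ, -⟩ := hr
  constructor
  · rw [SymHeap.subst, ptoCount_subst, hsp, ptoCount,
      Multiset.countP_cons_of_pos _ (fun h => h), Multiset.countP_eq_zero.2]
    exact fun a ha => not_not.2 (hQ a ha)
  · intro l hl
    obtain ⟨l', hl', rfl⟩ := Finset.mem_image.1 hl
    obtain ⟨k, t, t', rfl, -⟩ := hξ l' hl'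
    exact fun h => h

theorem spLocVars_caseSplit_ssubset {Q : Sequent L} {x y : ℕ} (hx : x ∈ alloc Q.lhs.sp)
    (hy : y ∉ alloc Q.lhs.sp) (hyr : (L.loc, y) ∈ spVars Q.rhs.sp) :
    (Q.subst (Subst.single L.loc x (.var y))).spLocVars ⊂ Q.spLocVars := by
  have hyx : y ≠ x := fun h => hy (h ▸ hx)
  have key : ∀ φ : Spatial L, ∀ n : ℕ,
      (L.loc, n) ∈ spVars (Spatial.subst (Subst.single L.loc x (.var y)) φ) →
      n = y ∨ n ≠ x ∧ (L.loc, n) ∈ spVars φ := by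
    intro φ n hn
    obtain ⟨c, hc, hcn⟩ := mem_spVars_subst.1 hn
    by_cases hcx : (c.1, c.2) = (L.loc, x)
    · obtain rfl : c = (L.loc, x) := hcx
      rw [Subst.single_self] at hcn
      exact .inl (congrArg Prod.snd hcn)
    · rw [Subst.single_of_ne hcx] at hcn
      obtain rfl : (L.loc, n) = c := hcn
      exact .inr ⟨fun h => hcx (by simp [h]), hc⟩
  have hne : ∀ n ∈ (Q.subst (Subst.single L.loc x (.var y))).spLocVars,
      n ≠ x ∧ n ∈ Q.spLocVars := by
    rintro n (hn | hn) <;> rcases key _ _ hn with rfl | ⟨h, h'⟩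
    · exact ⟨hyx, .inr hyr⟩
    · exact ⟨h, .inl h'⟩
    · exact ⟨hyx, .inr hyr⟩
    · exact ⟨h, .inr h'⟩
  refine (Set.ssubset_iff_of_subset fun n hn => (hne n hn).2).2
    ⟨x, .inl (root_mem_spVars hx), fun h => (hne x h).1 rfl⟩

/-- Weakening never makes a new case split possible: it only deletes disequations between
variables that are allocated or non-allocated, or disequations involving a variable that does not
occur elsewhere. -/
theorem undecided_weakening_subset {φ : Spatial L} {ξ ξ' : Pure L} {γ : SymHeap L}
    {V : Multiset ℕ}
    (hw : (∃ (k : L.Srt) (t t' : Term L k), ξ' = {Lit.ne k s(t, t')} ∧ Entails ⟨φ, ∅⟩ V ξ') ∨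
      (∃ (k : L.Srt) (x : ℕ),
        (k, x) ∉ spVars φ ∧ (k, x) ∉ pureVars ξ ∧ (k, x) ∉ γ.vars ∧
        ∀ l ∈ ξ', ∃ t : Term L k, t ≠ .var x ∧ l = .ne k s(.var x, t))) :
    Sequent.undecided ⟨⟨φ, ξ⟩, γ, V⟩ ⊆ Sequent.undecided ⟨⟨φ, ξ ∪ ξ'⟩, γ, V⟩ := by
  rintro ⟨x, y⟩ ⟨hx, hy, hyφ, hyV, hxy⟩
  refine ⟨hx, hy, hyφ, hyV, fun hc => ?_⟩
  rcases Finset.mem_union.1 hc with hc | hc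
  · exact hxy hc
  rcases hw with ⟨k, t, t', rfl, he⟩ | ⟨k, n, hnφ, -, hnγ, hl⟩
  · rcases he _ hc with h | ⟨k, n, h⟩ | ⟨k, c, d, -, h⟩ | ⟨x', y', h, hle⟩
    · simp at h
    · cases h
    · obtain rfl : L.loc = k := by injection h
      exact L.noLocConst.elim c
    · have hmem : y ∈ ({x', y'} : Multiset ℕ) := by
        simp only [Lit.ne.injEq, heq_eq_eq, true_and, Sym2.eq_iff, Term.var.injEq] at h
        rcases h with ⟨rfl, rfl⟩ | ⟨rfl, rfl⟩ <;> simp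
      exact (Multiset.mem_add.1 (Multiset.mem_of_le hle hmem)).elim hyφ hyV
  · obtain ⟨t, -, h⟩ := hl _ hc
    obtain rfl : L.loc = k := by injection h
    simp only [Lit.ne.injEq, heq_eq_eq, true_and, Sym2.eq_iff, Term.var.injEq] at h
    rcases h with ⟨rfl, -⟩ | ⟨-, rfl⟩
    · exact hnφ (root_mem_spVars hx)
    · exact hnγ (.inl hy)

/-! ### Soundness -/

theorem exists_of_forall₂ {α β : Type*} {P : α → β → Prop} {l : List α} {l' : List β}
    (H : List.Forall₂ P l l') {a : α} (ha : a ∈ l) : ∃ b ∈ l', P a b := by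
  induction H with
  | nil => cases ha
  | cons h _ ih =>
    rcases List.mem_cons.1 ha with rfl | ha
    · exact ⟨_, List.mem_cons_self, h⟩
    · obtain ⟨b, hb, hP⟩ := ih ha
      exact ⟨b, List.mem_cons_of_mem _ hb, hP⟩

/-- A counter-model of the conclusion of a rule application that fulfills the side conditions of
the strategy yields a counter-model of smaller rank of one of the premises. -/
theorem Step.exists_smaller_counterModel (hP : ∀ r ∈ R, r.IsPRule) {sel : Selection L}
    {Q : Sequent L} {a : App L} {prems : List (Sequent L)} (hstep : Step R Q a prems)
    (hside : SideCondition M R sel Q a) {s : Store M} {h : Heap M}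
    (H : Q.IsCounterModel M R s h) :
    ∃ Q' ∈ prems, ∃ (s' : Store M) (h' : Heap M), Q'.IsCounterModel M R s' h' ∧
      RankLT (Q'.rank h') (Q.rank h) := by
  cases hstep with
  | replacement φ ξ γ V k x t hx =>
    have hst : s k x = s.eval t := by
      have := H.1.2 _ (Finset.mem_insert_self _ _)
      simpa [Store.SatLit, Store.eval] using this
    have H' : Sequent.IsCounterModel M R ⟨⟨φ, ξ⟩, γ, V⟩ s h :=
      ⟨⟨H.1.1, fun l hl => H.1.2 l (Finset.mem_insert_of_mem hl)⟩, H.2⟩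
    refine ⟨_, List.mem_singleton_self _, s, h, H'.subst (Store.comp_single hst),
      rankLT_iff.2 (.inr ⟨rfl, .inl ((Sequent.workload_subst_le _ _ h).trans_lt ?_)⟩)⟩
    have : eqCount ξ < eqCount (insert (Lit.eq k s(.var x, t)) ξ) := by
      rw [eqCount, eqCount, Finset.filter_insert, if_pos (by trivial),
        Finset.card_insert_of_notMem (fun hm => hx (Finset.mem_filter.1 hm).1)]
      exact Nat.lt_succ_self _
    simp only [Sequent.workload]
    omega
  | elimination lam ψ ζ ζ' V hd hne he =>
    have H' := Sequent.isCounterModel_iff.1 H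
    refine ⟨_, List.mem_singleton_self _, s, h, ⟨H.1, fun hr => H.2.1 ⟨hr.1, fun l hl => ?_⟩,
      H.2.2⟩, rankLT_iff.2 (.inr ⟨rfl, .inl ?_⟩)⟩
    · exact (Finset.mem_union.1 hl).elim (hr.2 l) (he.satPure H.1.2
        (nodup_map_alloc_add hP H.1.1 subset_rfl H'.2.2.1 H'.2.2.2) l)
    · have := Finset.card_pos.2 hne
      simp only [Sequent.workload, Finset.card_union_of_disjoint hd]
      omega
  | separation φ₁ φ₂ ψ₁ ψ₂ ξ₁ ξ₂ ζ₁ ζ₂ V h₁ h₂ =>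
    obtain ⟨k₁, k₂, hu, H₁, H₂, hc⟩ := isCounterModel_separation hP H
    have hne : ∀ {φ : Spatial L} {k : Heap M}, SatSp M R s k φ → φ ≠ 0 → k.dom.Nonempty :=
      fun hk hφ => by
        obtain ⟨a, ha⟩ := Multiset.exists_mem_of_ne_zero hφ
        exact ⟨_, (hk.roots hP).1 _ (Multiset.mem_map_of_mem Atom.root ha)⟩
    rcases hc with hc | hc
    · exact ⟨_, by simp, s, k₁, hc, rankLT_iff.2 (.inl (hu.ncard_lt (hne H₂ h₂)))⟩
    · exact ⟨_, List.mem_cons_of_mem _ (List.mem_singleton_self _), s, k₂, hc,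
        rankLT_iff.2 (.inl (hu.symm.ncard_lt (hne H₁ h₁)))⟩
  | unfolding p x args φ ξ γ V rs hnd hrs prems hp =>
    obtain ⟨r, hr, hrp, hunf⟩ := exists_isCounterModel_unfolding H
    obtain ⟨Q', hQ', lam, hlam, hfresh, rfl⟩ :=
      exists_of_forall₂ hp ((hrs r).2 ⟨hr, hrp⟩)
    obtain ⟨s', H'⟩ := hunf lam hlam hfresh
    refine ⟨_, hQ', s', h, H', rankLT_iff.2 (.inr ⟨rfl, .inl ?_⟩)⟩
    obtain ⟨hpto, heq⟩ := hlam.counts (hP r hr)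
    have h1 : eqCount (lam.pure ∪ ξ) = eqCount ξ := by
      rw [eqCount, Finset.filter_union, Finset.filter_eq_empty_iff.2 (fun {l} hl => heq l hl),
        Finset.empty_union, eqCount]
    have h2 : ptoCount (lam.sp + φ) = ptoCount φ + 1 := by
      rw [← hpto, add_comm, ptoCount, ptoCount, ptoCount, Multiset.countP_add]
    have h3 : ptoCount (Atom.pred p x args ::ₘ φ) = ptoCount φ :=
      Multiset.countP_cons_of_neg _ fun hn => hn trivial
    -- the truncated subtraction in `workload` is harmless: points-to atoms are at most as many as
    -- the locations of the heap
    have h4 := (ptoCount_le_card _).trans (H'.1.1.card_le hP)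
    simp only at h4
    simp only [Sequent.workload, h1, h2, h3] at h4 ⊢
    omega
  | imitation x ys φ ξ p args ψ ζ V r hr us ψ' ζ' hu σ hdom hσ he =>
    have H' := Sequent.isCounterModel_iff.1 H
    have hζ := he.satPure H.1.2
      (nodup_map_alloc_add hP H.1.1 subset_rfl H'.2.2.1 H'.2.2.2)
    refine ⟨_, List.mem_singleton_self _, s, h, ⟨H.1, fun hr' => H.2.1 ⟨?_, hr'.2⟩, H.2.2⟩,
      rankLT_iff.2 (.inr ⟨rfl, .inl ?_⟩)⟩
    · have hsp := hr'.1
      rw [← Multiset.cons_add] at hsp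
      obtain ⟨h₁, h₂, hun, H₁, H₂⟩ := hsp.exists_add
      rw [← hσ] at H₁
      exact .sep _ _ _ _ _ _ hun (H₁.fold hr hu hdom hζ) H₂
    · have hrhs : Atom.pred p x args ::ₘ ψ = {Atom.pred p x args} := hside.2
      have h1 : ∀ b ∈ Atom.pred p x args ::ₘ ψ, b.IsPred := by
        rw [hrhs]
        simp [Atom.IsPred]
      have h2 : ¬ ∀ b ∈ Atom.pto x ys ::ₘ (Spatial.subst σ ψ' + ψ), b.IsPred :=
        fun hc => hc _ (Multiset.mem_cons_self _ _)
      simp only [Sequent.workload, if_pos h1, if_neg h2]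
      omega
  | weakening φ ξ ξ' γ V hd hne hw =>
    have h1 : eqCount ξ ≤ eqCount (ξ ∪ ξ') := eqCount_mono Finset.subset_union_left
    have h2 := Set.ncard_le_ncard (undecided_weakening_subset hw)
      (Sequent.undecided_finite ⟨⟨φ, ξ ∪ ξ'⟩, γ, V⟩)
    refine ⟨_, List.mem_singleton_self _, s, h, ⟨⟨H.1.1, fun l hl => H.1.2 l
      (Finset.mem_union_left _ hl)⟩, H.2⟩, Sequent.rank_lt_rank ?_ (.inr ⟨rfl, .inr ⟨h2, ?_⟩⟩)⟩
    · simp only [Sequent.workload]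
      omega
    · have := Finset.card_pos.2 hne
      simp only [Finset.card_union_of_disjoint hd]
      omega
  | caseSplit φ ξ γ V x y =>
    obtain ⟨hpure, hx, hyr, hyφ, hyV, -, hxy⟩ := hside
    have hyr' : (L.loc, y) ∈ spVars γ.sp := by
      rcases hyr with h | ⟨l, hl, -⟩
      · exact h
      · rw [show γ.pure = ∅ from hpure] at hl
        cases hl
    by_cases hs : s L.loc x = s L.loc y
    · refine ⟨_, List.mem_cons_self, s, h, H.subst (Store.comp_single hs),
        Sequent.rank_lt_rank (Sequent.workload_subst_le _ _ h) (.inl ?_)⟩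
      exact Set.ncard_lt_ncard (spLocVars_caseSplit_ssubset hx hyφ hyr')
        (Sequent.spLocVars_finite _)
    · refine ⟨_, List.mem_cons_of_mem _ (List.mem_singleton_self _), s, h,
        ⟨⟨H.1.1, fun l hl => ?_⟩, H.2⟩,
        Sequent.rank_lt_rank ?_ (.inr ⟨rfl, .inl ?_⟩)⟩
      · rcases Finset.mem_insert.1 hl with rfl | hl
        · simpa [Store.SatLit, Store.eval] using hs
        · exact H.1.2 l hl
      · have h1 : eqCount (insert (Lit.ne L.loc s(.var x, .var y)) ξ) = eqCount ξ := by
          rw [eqCount, Finset.filter_insert, if_neg (by exact fun hn => hn), eqCount]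
        simp only [Sequent.workload, h1]
        omega
      · refine Set.ncard_lt_ncard ((Set.ssubset_iff_of_subset fun c hc => ?_).2
          ⟨(x, y), ⟨hx, hyr', hyφ, hyV, hxy⟩, fun hc =>
            hc.2.2.2.2 (Finset.mem_insert_self _ _)⟩) (Sequent.undecided_finite _)
        exact ⟨hc.1, hc.2.1, hc.2.2.1, hc.2.2.2.1, fun hm =>
          hc.2.2.2.2 (Finset.mem_insert_of_mem hm)⟩
  | varWeakening lam γ V x hl hr =>
    have H' := Sequent.isCounterModel_iff.1 H
    have hsub : Sequent.undecided ⟨lam, γ, V⟩ ⊆ Sequent.undecided ⟨lam, γ, x ::ₘ V⟩ := by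
      rintro c ⟨h1, h2, h3, h4, h5⟩
      refine ⟨h1, h2, h3, fun hm => ?_, h5⟩
      rcases Multiset.mem_cons.1 hm with rfl | hm
      · exact hr (.inl h2)
      · exact h4 hm
    refine ⟨_, List.mem_singleton_self _, s, h, Sequent.isCounterModel_iff.2
      ⟨H.1, H.2.1, fun n hn => H'.2.2.1 n (Multiset.mem_cons_of_mem hn), ?_⟩,
      Sequent.rank_lt_rank le_rfl (.inr ⟨rfl, .inr
        ⟨Set.ncard_le_ncard hsub (Sequent.undecided_finite _), ?_⟩⟩)⟩
    · have := H'.2.2.2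
      rw [Multiset.map_cons, Multiset.nodup_cons] at this
      exact this.2
    · simp only [Multiset.card_cons]
      omega

end

end SepLog

theorem mainTheorem2 (L : SepLog.Signature) (M : SepLog.Universe L)
    (R : Set (SepLog.IRule L)) (hfin : R.Finite) (hP : ∀ r ∈ R, r.IsPRule)
    (hdet : SepLog.LocDeterministic M R) (sel : SepLog.Selection L)
    (T : SepLog.ProofTree R) (hadm : T.Admissible M sel) (hfull : T.FullyExpanded) :
    T.root.IsValid M R := by
  suffices key : ∀ b, ∀ π ∈ T.nodes, ∀ (s : SepLog.Store M) (h : SepLog.Heap M),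
      (T.label π).rank h = b → ¬ (T.label π).IsCounterModel M R s h from
    fun s h => key _ [] T.root_mem s h rfl
  intro b
  induction b using SepLog.rankLT_wf.induction with
  | _ b ih =>
    rintro π hπ s h rfl H
    by_cases hchild : ∃ i, π ++ [i] ∈ T.nodes
    -- a node with children has a premise with a smaller counter-model; an application of `U` to a
    -- predicate without rules has no premise, so that such a node is a leaf, hence an axiom
    · obtain ⟨prems, hstep, hprems⟩ := T.step π hπ hchild
      have hne : prems ≠ [] := by
        rintro rfl
        obtain ⟨i, hi⟩ := hchild
        exact Nat.not_lt_zero _ ((hprems i).1.1 hi)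
      have hside := (hadm π hπ prems hne hprems).1.2.2.2.2
      obtain ⟨Q', hQ', s', h', H', hlt⟩ := hstep.exists_smaller_counterModel hP hside H
      obtain ⟨i, hi, rfl⟩ := List.mem_iff_getElem.1 hQ'
      have hmem := (hprems i).1.2 hi
      have hlab : prems[i] = T.label (π ++ [i]) := by
        simpa [hi] using (hprems i).2 hmem
      rw [hlab] at H' hlt
      exact ih _ hlt _ hmem s' h' rfl H'
    · exact (hfull π ⟨hπ, fun i hi => hchild ⟨i, hi⟩⟩).not_isCounterModel hP s h H
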